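/- Let $p$ be a prime, $n\ge 1$ an integer, and let $\mathbb{Q}_p^n$ carry the norm $|x|_p=\max_j|x_j|_p$ and the Haar measure $dx$ with $|E|_h=\int_E dx$, normalized so that $|B_0(0)|_h=1$, where $B_\gamma(x)=\{y\in\mathbb{Q}_p^n:|y-x|_p\le p^\gamma\}$ for $\gamma\in\mathbb{Z}$. For a locally integrable $b:\mathbb{Q}_p^n\to\mathbb{R}$ put $b_B=|B|_h^{-1}\int_B b\,dx$ for a ball $B$ and $$\mathcal{M}_b^p(f)(x)=\sup_{\gamma\in\mathbb{Z}}\frac{1}{|B_\gamma(x)|_h}\int_{B_\gamma(x)}|b(x)-b(y)|\,|f(y)|\,dy .$$ For $\beta\in(0,1)$, $\Lambda_\beta(\mathbb{Q}_p^n)$ is the set of measurable functions that agree almost everywhere with a measurable function $f$ such that $\sup_{x\ne y}|f(x)-f(y)|/|x-y|_p^\beta<\infty$. For measurable $q(\cdot)$ let $q_-(E)$ and $q_+(E)$ be its essential infimum and supremum over $E$, and $q_\pm=q_\pm(\mathbb{Q}_p^n)$. Let $\mathscr{P}(\mathbb{Q}_p^n)$ be the set of measurable $q(\cdot):\mathbb{Q}_p^n\to(1,\infty)$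 with $1<q_-\le q(x)\le q_+<\infty$ for all $x$, and let $\mathscr{C}^{\log}(\mathbb{Q}_p^n)$ be the set of $q(\cdot)\in\mathscr{P}(\mathbb{Q}_p^n)$ for which there is a constant $C$ with $\gamma\,\big(q_-(B_\gamma(x))-q_+(B_\gamma(x))\big)\le C$ for all $\gamma\in\mathbb{Z}$, $x\in\mathbb{Q}_p^n$, and $|q(x)-q(y)|\le C/\log_p(p+\min\{|x|_p,|y|_p\})$ for all $x,y\in\mathbb{Q}_p^n$. For $q(\cdot)\in\mathscr{P}(\mathbb{Q}_p^n)$, $L^{q(\cdot)}(\mathbb{Q}_p^n)$ is the space of measurable $f$ with $\int(|f(x)|/\eta)^{q(x)}dx<\infty$ for some $\eta>0$, with the norm $\|f\|_{L^{q(\cdot)}}=\inf\{\eta>0:\int(|f(x)|/\eta)^{q(x)}dx\le1\}$. An operator $T$ is bounded from $L^{r(\cdot)}(\mathbb{Q}_p^n)$ to $L^{q(\cdot)}(\mathbb{Q}_p^n)$ if there is a constant $C$ such that $Tf\in L^{q(\cdot)}(\mathbb{Q}_p^n)$ and $\|Tf\|_{L^{q(\cdot)}}\le C\|f\|_{L^{r(\cdot)}}$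 for all $f\in L^{r(\cdot)}(\mathbb{Q}_p^n)$. Let $0<\beta<1$ and let $b$ be a locally integrable function on $\mathbb{Q}_p^n$. Call $(r(\cdot),q(\cdot))$ admissible if $r(\cdot),q(\cdot)\in\mathscr{C}^{\log}(\mathbb{Q}_p^n)$, $r_+<n/\beta$ and $1/q(\cdot)=1/r(\cdot)-\beta/n$. Then the following statements are equivalent: 1. $b\in\Lambda_\beta(\mathbb{Q}_p^n)$. 2. $\mathcal{M}_b^p$ is bounded from $L^{r(\cdot)}(\mathbb{Q}_p^n)$ to $L^{q(\cdot)}(\mathbb{Q}_p^n)$ for all admissible $(r(\cdot),q(\cdot))$. 3. $\mathcal{M}_b^p$ is bounded from $L^{r(\cdot)}(\mathbb{Q}_p^n)$ to $L^{q(\cdot)}(\mathbb{Q}_p^n)$ for some admissible $(r(\cdot),q(\cdot))$. 4. For some admissible $(r(\cdot),q(\cdot))$, $$\sup_{\gamma\in\mathbb{Z},\,x\in\mathbb{Q}_p^n}\frac{1}{|B_\gamma(x)|_h^{\beta/n}}\,\frac{\big\|(b-b_{B_\gamma(x)})\chi_{B_\gamma(x)}\big\|_{L^{q(\cdot)}}}{\|\chi_{B_\gamma(x)}\|_{L^{q(\cdot)}}}<\infty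 .\tag{$*$}$$ 5. $(*)$ holds for all admissible $(r(\cdot),q(\cdot))$. -/

import Mathlib

open MeasureTheory
open scoped ENNReal NNReal

namespace PadicVar

noncomputable section

/-- The Borel `σ`-algebra on `ℚ_p`. -/
instance instMeasurableSpacePadic (p : ℕ) [Fact p.Prime] : MeasurableSpace ℚ_[p] := borel _

instance instBorelSpacePadic (p : ℕ) [Fact p.Prime] : BorelSpace ℚ_[p] := ⟨rfl⟩

/-- The vector space `ℚ_p^n`. Its norm is the maximum norm `|x|_p = max_j |x_j|_p`. -/
abbrev Qpn (p n : ℕ) [Fact p.Prime] : Type := Fin n → ℚ_[p]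

/-- The closed unit ball `B_0(0)` of `ℚ_p^n`, a compact set with non-empty interior. -/
def unitBall (p n : ℕ) [Fact p.Prime] : TopologicalSpace.PositiveCompacts (Qpn p n) where
  carrier := Metric.closedBall 0 1
  isCompact' := isCompact_closedBall 0 1
  interior_nonempty' :=
    ⟨0, Metric.ball_subset_interior_closedBall (Metric.mem_ball_self one_pos)⟩

/-- The Haar measure of `ℚ_p^n`, normalized so that the closed unit ball has measure `1`. -/
def haar (p n : ℕ) [Fact p.Prime] : Measure (Qpn p n) :=
  Measure.addHaarMeasure (unitBall p n)

variable {p n : ℕ} [Fact p.Prime]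

/-- The ball `B_γ(a) = {x : |x - a|_p ≤ p ^ γ}`. -/
def pBall (γ : ℤ) (a : Qpn p n) : Set (Qpn p n) := Metric.closedBall a ((p : ℝ) ^ γ)

/-- The class `𝒫(ℚ_p^n)`: measurable exponents with `1 < q₋ ≤ q(x) ≤ q₊ < ∞` for all `x`, where
`q₋` and `q₊` are the essential infimum and the essential supremum. -/
structure IsExponent (q : Qpn p n → ℝ) : Prop where
  measurable : Measurable q
  bddAbove : BddAbove (Set.range q)
  one_lt_essInf : 1 < essInf q (haar p n)
  essInf_le : ∀ x, essInf q (haar p n) ≤ q x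
  le_essSup : ∀ x, q x ≤ essSup q (haar p n)

/-- The class `𝒞^log(ℚ_p^n)` of globally log-Hölder continuous exponents in `𝒫(ℚ_p^n)`. -/
structure IsLogHolder (q : Qpn p n → ℝ) : Prop where
  isExponent : IsExponent q
  local_cond : ∃ C : ℝ, ∀ (γ : ℤ) (x : Qpn p n),
    (γ : ℝ) * (essInf q ((haar p n).restrict (pBall γ x)) -
      essSup q ((haar p n).restrict (pBall γ x))) ≤ C
  infinity_cond : ∃ C : ℝ, ∀ x y : Qpn p n,
    |q x - q y| ≤ C / Real.logb p (p + min ‖x‖ ‖y‖)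

section Lebesgue

variable {ε : Type*} [TopologicalSpace ε] [ContinuousENorm ε]

/-- The modular of `f / η`, that is `∫ (|f(x)| / η) ^ q(x) dx`. -/
def modular (q : Qpn p n → ℝ) (f : Qpn p n → ε) (η : ℝ≥0) : ℝ≥0∞ :=
  ∫⁻ x, (‖f x‖ₑ / (η : ℝ≥0∞)) ^ (q x) ∂(haar p n)

/-- The Luxemburg norm on `L^{q(·)}(ℚ_p^n)`; it is `∞` where the infimum is over the empty set. -/
def luxNorm (q : Qpn p n → ℝ) (f : Qpn p n → ε) : ℝ≥0∞ :=
  ⨅ η ∈ {η : ℝ≥0 | 0 < η ∧ modular q f η ≤ 1}, (η : ℝ≥0∞)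

/-- Membership in the variable exponent Lebesgue space `L^{q(·)}(ℚ_p^n)`. For functions with
values in `[0, ∞]` it forces the function to be finite almost everywhere. -/
def MemLvar (q : Qpn p n → ℝ) (f : Qpn p n → ε) : Prop :=
  AEStronglyMeasurable f (haar p n) ∧ ∃ η : ℝ≥0, 0 < η ∧ modular q f η < ∞

end Lebesgue

/-- The maximal commutator `M_b^p (f)(x)`, the supremum over `γ ∈ ℤ` of the averages of
`|b(x) - b(y)| |f(y)|` over `B_γ(x)`, with values in `[0, ∞]`. -/
def maximalCommutator (b f : Qpn p n → ℝ) (x : Qpn p n) : ℝ≥0∞ :=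
  ⨆ γ : ℤ, (haar p n (pBall γ x))⁻¹ *
    ∫⁻ y in pBall γ x, ‖b x - b y‖ₑ * ‖f y‖ₑ ∂(haar p n)

/-- `M_b^p` is bounded from `L^{r(·)}(ℚ_p^n)` to `L^{q(·)}(ℚ_p^n)`. -/
def CommutatorBounded (b r q : Qpn p n → ℝ) : Prop :=
  ∃ C : ℝ≥0, ∀ f : Qpn p n → ℝ, MemLvar r f →
    MemLvar q (maximalCommutator b f) ∧ luxNorm q (maximalCommutator b f) ≤ C * luxNorm r f

/-- The exponents `r(·), q(·) ∈ 𝒞^log` with `r(·) ∈ 𝒫`, `r₊ < n / β` and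
`1 / q(·) = 1 / r(·) - β / n`. -/
structure AdmissiblePair (β : ℝ) (r q : Qpn p n → ℝ) : Prop where
  logHolder_r : IsLogHolder r
  logHolder_q : IsLogHolder q
  essSup_lt : essSup r (haar p n) < n / β
  one_div_eq : ∀ x, 1 / q x = 1 / r x - β / n

/-- The quantity
`sup_{γ, x} |B_γ(x)|^{-β/n} ‖(b - b_{B_γ(x)}) χ_{B_γ(x)}‖_{q(·)} / ‖χ_{B_γ(x)}‖_{q(·)}`. -/
def oscillation (β : ℝ) (b q : Qpn p n → ℝ) : ℝ≥0∞ :=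
  ⨆ (γ : ℤ) (x : Qpn p n), ((haar p n (pBall γ x)) ^ (β / n))⁻¹ *
    (luxNorm q ((pBall γ x).indicator fun y => b y - ⨍ z in pBall γ x, b z ∂(haar p n)) /
      luxNorm q ((pBall γ x).indicator fun _ => (1 : ℝ)))

/-- The homogeneous Lipschitz seminorm `sup_{x ≠ y} |f(x) - f(y)| / |x - y|_p ^ β`. -/
def lipNorm (β : ℝ) (f : Qpn p n → ℝ) : ℝ≥0∞ :=
  ⨆ (x : Qpn p n) (y : Qpn p n) (_ : x ≠ y), ‖f x - f y‖ₑ / ‖x - y‖ₑ ^ β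

/-- `b ∈ Λ_β(ℚ_p^n)`. Locally integrable functions are identified when they agree almost
everywhere, so the requirement is that some representative of `b` has finite seminorm. -/
def MemLipschitz (β : ℝ) (b : Qpn p n → ℝ) : Prop :=
  ∃ f : Qpn p n → ℝ, Measurable f ∧ f =ᵐ[haar p n] b ∧ lipNorm β f < ∞

end

end PadicVar

/-
Let `Λ` be the Lipschitz constant of `b`. On `B_γ(x)` one has `|b x - b y| ≤ Λ p ^ (γ β)`, so the
maximal commutator is dominated by `Λ` times the fractional maximal function of order `β / n`. For
`f` with modular at most one, split `f` into the part where `f ≥ 1` and the part where `f < 1`: on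
the first the log-Hölder condition on small balls, on the second the one at infinity, allows
the exponent to be frozen, and both reduce the fractional maximal function to the Hardy–Littlewood
maximal function on a space of constant exponent `r₋ > 1`.

Conversely, averaging over `B = B_γ(x)` shows that `|b - b_B| ≤ M_b(χ_B)` on `B`, and the norm of
`χ_B` is comparable to `p ^ (n γ / q₀)` for a frozen value `q₀` of the exponent; hence boundedness
of `M_b` gives `(*)`. Hölder's inequality turns `(*)` into `⨍_B |b - b_B| ≤ C p ^ (γ β)`, the
averages `b_{B_γ(x)}` then form a geometric Cauchy sequence as `γ → -∞`, and their limit is a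
Lipschitz function equal to `b` almost everywhere by Lebesgue's differentiation theorem.
-/

namespace PadicVar

open Metric Set Filter Topology

variable {p n : ℕ} [Fact p.Prime]

section Prime

variable (p)

lemma one_lt_prime : (1 : ℝ) < p := by
  exact_mod_cast (Fact.out : p.Prime).one_lt

lemma prime_pos : (0 : ℝ) < p :=
  one_pos.trans (one_lt_prime p)

lemma prime_ne_zero : (p : ℝ≥0∞) ≠ 0 := by
  exact_mod_cast (Fact.out : p.Prime).ne_zero

lemma one_le_prime : (1 : ℝ≥0∞) ≤ p := by
  exact_mod_cast (Fact.out : p.Prime).one_lt.le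

lemma prime_rpow_ne_zero (t : ℝ) : (p : ℝ≥0∞) ^ t ≠ 0 :=
  (ENNReal.rpow_pos (pos_iff_ne_zero.2 (prime_ne_zero p)) (ENNReal.natCast_ne_top p)).ne'

lemma prime_rpow_ne_top (t : ℝ) : (p : ℝ≥0∞) ^ t ≠ ∞ :=
  ENNReal.rpow_ne_top_of_ne_zero (prime_ne_zero p) (ENNReal.natCast_ne_top p)

lemma prime_rpow_add (s t : ℝ) : (p : ℝ≥0∞) ^ (s + t) = (p : ℝ≥0∞) ^ s * (p : ℝ≥0∞) ^ t :=
  ENNReal.rpow_add s t (prime_ne_zero p) (ENNReal.natCast_ne_top p)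

end Prime

section Ball

lemma mem_pBall {γ : ℤ} {a x : Qpn p n} : x ∈ pBall γ a ↔ ‖x - a‖ ≤ (p : ℝ) ^ γ := by
  rw [pBall, mem_closedBall, dist_eq_norm]

lemma mem_pBall_iff_forall {γ : ℤ} {a x : Qpn p n} :
    x ∈ pBall γ a ↔ ∀ i, ‖x i - a i‖ ≤ (p : ℝ) ^ γ := by
  rw [mem_pBall, pi_norm_le_iff_of_nonneg (zpow_nonneg (prime_pos p).le γ)]
  rfl

lemma mem_pBall_self (γ : ℤ) (x : Qpn p n) : x ∈ pBall γ x :=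
  mem_closedBall_self (zpow_nonneg (prime_pos p).le γ)

lemma measurableSet_pBall (γ : ℤ) (a : Qpn p n) : MeasurableSet (pBall γ a) :=
  isClosed_closedBall.measurableSet

lemma pBall_eq_of_mem {γ : ℤ} {a x : Qpn p n} (h : x ∈ pBall γ a) : pBall γ x = pBall γ a :=
  (IsUltrametricDist.closedBall_eq_of_mem h).symm

lemma pBall_mono {γ δ : ℤ} (h : γ ≤ δ) (a : Qpn p n) : pBall γ a ⊆ pBall δ a :=
  closedBall_subset_closedBall (zpow_le_zpow_right₀ (one_lt_prime p).le h)

end Ball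

section Haar

instance : (haar p n).IsAddHaarMeasure := by unfold haar; infer_instance

lemma existsUnique_digit {x : ℚ_[p]} (hx : ‖x‖ ≤ 1) : ∃! d : Fin p, ‖x - (d : ℕ)‖ < 1 := by
  let z : ℤ_[p] := ⟨x, hx⟩
  have hiff : ∀ d : ℕ, ‖x - d‖ < 1 ↔ z - d ∈ IsLocalRing.maximalIdeal ℤ_[p] := fun d => by
    rw [IsLocalRing.mem_maximalIdeal, PadicInt.mem_nonunits, PadicInt.norm_def,
      PadicInt.coe_sub, PadicInt.coe_natCast]
  obtain ⟨d, ⟨hd, hxd⟩, huniq⟩ := PadicInt.existsUnique_mem_range z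
  exact ⟨⟨d, hd⟩, (hiff d).2 hxd, fun e he => Fin.ext (huniq e ⟨e.2, (hiff e).1 he⟩)⟩

lemma existsUnique_digit_of_norm_le {γ : ℤ} {x : ℚ_[p]} (hx : ‖x‖ ≤ (p : ℝ) ^ (γ + 1)) :
    ∃! d : Fin p, ‖x - (p : ℚ_[p]) ^ (-(γ + 1)) * (d : ℕ)‖ ≤ (p : ℝ) ^ γ := by
  have hp' : (p : ℚ_[p]) ≠ 0 := by exact_mod_cast (Fact.out : p.Prime).ne_zero
  have hx' : ‖(p : ℚ_[p]) ^ (γ + 1) * x‖ ≤ 1 := by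
    rw [norm_mul, Padic.norm_p_zpow, zpow_neg]
    exact inv_mul_le_one_of_le₀ hx (zpow_nonneg (prime_pos p).le _)
  convert existsUnique_digit hx' using 2 with d
  have h : (p : ℚ_[p]) ^ (γ + 1) * x - (d : ℕ) =
      (p : ℚ_[p]) ^ (γ + 1) * (x - (p : ℚ_[p]) ^ (-(γ + 1)) * (d : ℕ)) := by
    rw [zpow_neg, mul_sub, mul_inv_cancel_left₀ (zpow_ne_zero _ hp')]
  rw [h, norm_mul, Padic.norm_p_zpow, zpow_neg (p : ℝ), inv_mul_lt_one₀ (zpow_pos (prime_pos p) _),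
    Padic.norm_le_pow_iff_norm_lt_pow_add_one]

lemma haar_pBall_eq_haar_pBall_zero (γ : ℤ) (a : Qpn p n) :
    haar p n (pBall γ a) = haar p n (pBall γ 0) := by
  rw [← measure_preimage_add (haar p n) (-a) (pBall γ 0)]
  congr 1
  ext y
  simp only [mem_pBall, mem_preimage, sub_zero, neg_add_eq_sub]

lemma haar_pBall_succ (γ : ℤ) :
    haar p n (pBall (γ + 1) 0) = (p : ℝ≥0∞) ^ n * haar p n (pBall γ 0) := by
  let c : (Fin n → Fin p) → Qpn p n := fun d i => (p : ℚ_[p]) ^ (-(γ + 1)) * (d i : ℕ)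
  have hc : ∀ d, c d ∈ pBall (γ + 1) 0 := fun d => mem_pBall_iff_forall.2 fun i => by
    rw [Pi.zero_apply, sub_zero, norm_mul, Padic.norm_p_zpow, neg_neg]
    exact mul_le_of_le_one_right (zpow_nonneg (prime_pos p).le _) (Padic.norm_int_le_one (d i : ℕ))
  have hunion : pBall (γ + 1) 0 = ⋃ d, pBall γ (c d) := by
    refine Subset.antisymm (fun y hy => mem_iUnion.2 ?_) (iUnion_subset fun d => ?_)
    · have hy' : ∀ i, ‖y i‖ ≤ (p : ℝ) ^ (γ + 1) := by simpa using mem_pBall_iff_forall.1 hy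
      choose d hd using fun i => (existsUnique_digit_of_norm_le (hy' i)).exists
      exact ⟨d, mem_pBall_iff_forall.2 hd⟩
    · exact (pBall_mono (by lia) _).trans_eq (pBall_eq_of_mem (hc d))
  have hdisj : Pairwise (Function.onFun Disjoint fun d => pBall γ (c d)) := fun d e hde =>
    Set.disjoint_left.2 fun y hd he => hde <| funext fun i => by
      have hy : ‖y i‖ ≤ (p : ℝ) ^ (γ + 1) := by
        simpa using mem_pBall_iff_forall.1 (hunion.superset (mem_iUnion.2 ⟨d, hd⟩)) i
      exact (existsUnique_digit_of_norm_le hy).unique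
        (mem_pBall_iff_forall.1 hd i) (mem_pBall_iff_forall.1 he i)
  rw [hunion, measure_iUnion hdisj fun d => measurableSet_pBall _ _]
  simp only [haar_pBall_eq_haar_pBall_zero _ (c _)]
  simp

lemma haar_pBall (γ : ℤ) (a : Qpn p n) :
    haar p n (pBall γ a) = (p : ℝ≥0∞) ^ ((n : ℝ) * γ) := by
  have hstep : ∀ δ : ℤ, (p : ℝ≥0∞) ^ ((n : ℝ) * (δ + 1 : ℤ)) =
      (p : ℝ≥0∞) ^ n * (p : ℝ≥0∞) ^ ((n : ℝ) * δ) := fun δ => by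
    rw [← ENNReal.rpow_natCast, ← prime_rpow_add]
    push_cast
    ring_nf
  rw [haar_pBall_eq_haar_pBall_zero]
  induction γ with
  | zero =>
    have h : pBall 0 (0 : Qpn p n) = unitBall p n := by
      rw [pBall, zpow_zero]
      rfl
    rw [h, haar, Measure.addHaarMeasure_self, Int.cast_zero, mul_zero, ENNReal.rpow_zero]
  | succ k ih => rw [haar_pBall_succ, ih, hstep]
  | pred k ih =>
    have h := haar_pBall_succ (p := p) (n := n) (-(k : ℤ) - 1)
    have h' := hstep (-(k : ℤ) - 1)
    rw [sub_add_cancel] at h h'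
    rw [ih, h'] at h
    exact ((ENNReal.mul_right_inj (pow_ne_zero _ (prime_ne_zero p))
      (ENNReal.pow_ne_top (ENNReal.natCast_ne_top p))).1 h).symm

lemma haar_pBall_ne_zero (γ : ℤ) (a : Qpn p n) : haar p n (pBall γ a) ≠ 0 := by
  rw [haar_pBall]
  exact prime_rpow_ne_zero p _

lemma haar_pBall_ne_top (γ : ℤ) (a : Qpn p n) : haar p n (pBall γ a) ≠ ∞ := by
  rw [haar_pBall]
  exact prime_rpow_ne_top p _

instance (γ : ℤ) (a : Qpn p n) : NeZero ((haar p n).restrict (pBall γ a)) :=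
  ⟨by simpa using haar_pBall_ne_zero γ a⟩

instance (γ : ℤ) (a : Qpn p n) : IsFiniteMeasure ((haar p n).restrict (pBall γ a)) :=
  ⟨by simpa using (haar_pBall_ne_top γ a).lt_top⟩

lemma haar_pBall_add (γ δ : ℤ) (x : Qpn p n) :
    haar p n (pBall (γ + δ) x) = (p : ℝ≥0∞) ^ ((n : ℝ) * δ) * haar p n (pBall γ x) := by
  rw [haar_pBall, haar_pBall, ← prime_rpow_add]
  push_cast
  ring_nf

lemma haar_pBall_rpow_div (hn : n ≠ 0) (β : ℝ) (γ : ℤ) (x : Qpn p n) :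
    haar p n (pBall γ x) ^ (β / n) = (p : ℝ≥0∞) ^ (γ * β) := by
  rw [haar_pBall, ← ENNReal.rpow_mul]
  congr 1
  field_simp

instance : IsUnifLocDoublingMeasure (haar p n) := by
  refine ⟨(p : ℝ≥0) ^ (2 * (n : ℝ)), eventually_nhdsWithin_of_forall fun ε hε x => ?_⟩
  obtain ⟨γ, hγ, hγ'⟩ := exists_mem_Ico_zpow hε (one_lt_prime p)
  have h2p : (2 : ℝ) ≤ p := by exact_mod_cast (Fact.out : p.Prime).two_le
  have hsub : closedBall x (2 * ε) ⊆ pBall (γ + 2) x := by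
    refine closedBall_subset_closedBall ?_
    rw [show γ + 2 = 1 + (γ + 1) by ring, zpow_add₀ (prime_pos p).ne', zpow_one]
    exact mul_le_mul h2p hγ'.le hε.le (prime_pos p).le
  calc haar p n (closedBall x (2 * ε)) ≤ haar p n (pBall (γ + 2) x) := measure_mono hsub
    _ = (p : ℝ≥0∞) ^ (2 * (n : ℝ)) * haar p n (pBall γ x) := by
      rw [haar_pBall_add, Int.cast_ofNat, mul_comm (n : ℝ)]
    _ ≤ _ := by
      rw [ENNReal.coe_rpow_of_nonneg _ (by positivity), ENNReal.coe_natCast]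
      gcongr
      exact closedBall_subset_closedBall hγ

end Haar

section DecayWeight

/-- The weight `(p + |y|) ^ (-(n + 1))`, an integrable function that decays only polynomially: it
absorbs the errors made when an exponent is compared with its value at infinity. -/
noncomputable def decayWeight (y : Qpn p n) : ℝ≥0∞ :=
  ENNReal.ofReal (((p : ℝ) + ‖y‖) ^ (-((n : ℝ) + 1)))

lemma measurable_decayWeight : Measurable (decayWeight (p := p) (n := n)) := by
  unfold decayWeight
  fun_prop

lemma decayWeight_le_one (y : Qpn p n) : decayWeight y ≤ 1 :=
  ENNReal.ofReal_le_one.2 <| Real.rpow_le_one_of_one_le_of_nonpos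
    (by linarith [one_lt_prime p, norm_nonneg y]) (by linarith [n.cast_nonneg (α := ℝ)])

lemma decayWeight_le_tsum_indicator (y : Qpn p n) : decayWeight y ≤ ∑' k : ℕ,
    (pBall ((k : ℤ) + 1) 0).indicator (fun _ => (p : ℝ≥0∞) ^ (-(((n : ℝ) + 1) * k))) y := by
  have hpy : 1 ≤ (p : ℝ) + ‖y‖ := by linarith [one_lt_prime p, norm_nonneg y]
  obtain ⟨k, hk, hk'⟩ := exists_nat_pow_near hpy (one_lt_prime p)
  have hy : y ∈ pBall ((k : ℤ) + 1) 0 := by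
    rw [mem_pBall, sub_zero, ← Nat.cast_succ, zpow_natCast]
    exact (le_add_of_nonneg_left (prime_pos p).le).trans hk'.le
  refine le_trans ?_ (ENNReal.le_tsum k)
  rw [indicator_of_mem hy, ← ENNReal.ofReal_natCast p, ENNReal.ofReal_rpow_of_pos (prime_pos p)]
  refine ENNReal.ofReal_le_ofReal ?_
  calc ((p : ℝ) + ‖y‖) ^ (-((n : ℝ) + 1)) ≤ ((p : ℝ) ^ k) ^ (-((n : ℝ) + 1)) :=
        Real.rpow_le_rpow_of_nonpos (pow_pos (prime_pos p) k) hk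
          (by linarith [n.cast_nonneg (α := ℝ)])
    _ = (p : ℝ) ^ (-(((n : ℝ) + 1) * k)) := by
        rw [← Real.rpow_natCast, ← Real.rpow_mul (prime_pos p).le]
        ring_nf

lemma lintegral_decayWeight_lt_top : ∫⁻ y, decayWeight (p := p) (n := n) y ∂(haar p n) < ∞ := by
  have hterm : ∀ k : ℕ, (p : ℝ≥0∞) ^ (-(((n : ℝ) + 1) * k)) *
      haar p n (pBall ((k : ℤ) + 1) 0) = (p : ℝ≥0∞) ^ (n : ℝ) * ((p : ℝ≥0∞)⁻¹) ^ k := fun k => by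
    rw [haar_pBall, ← prime_rpow_add, ← ENNReal.rpow_natCast, ← ENNReal.rpow_neg_one,
      ← ENNReal.rpow_mul, ← prime_rpow_add]
    push_cast
    ring_nf
  calc ∫⁻ y, decayWeight (p := p) (n := n) y ∂(haar p n)
      ≤ ∫⁻ y, ∑' k : ℕ, (pBall ((k : ℤ) + 1) 0).indicator
          (fun _ => (p : ℝ≥0∞) ^ (-(((n : ℝ) + 1) * k))) y ∂(haar p n) :=
        lintegral_mono decayWeight_le_tsum_indicator
    _ = ∑' k : ℕ, (p : ℝ≥0∞) ^ (n : ℝ) * ((p : ℝ≥0∞)⁻¹) ^ k := by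
        rw [lintegral_tsum fun k =>
          (measurable_const.indicator (measurableSet_pBall _ _)).aemeasurable]
        simp only [lintegral_indicator_const (measurableSet_pBall _ _), hterm]
    _ < ∞ := by
        rw [ENNReal.tsum_mul_left, ENNReal.tsum_geometric]
        refine ENNReal.mul_lt_top (prime_rpow_ne_top p _).lt_top ?_
        rw [ENNReal.inv_lt_top, tsub_pos_iff_lt, ENNReal.inv_lt_one]
        exact_mod_cast (Fact.out : p.Prime).one_lt

end DecayWeight

section Lintegral

variable {α : Type*} [MeasurableSpace α] {μ : Measure α}

lemma iSup_rpow {ι : Sort*} (f : ι → ℝ≥0∞) {s : ℝ} (hs : 0 < s) :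
    (⨆ i, f i) ^ s = ⨆ i, f i ^ s := by
  simpa only [ENNReal.orderIsoRpow_apply] using (ENNReal.orderIsoRpow s hs).map_iSup f

lemma iSup_min_natCast (a : ℝ≥0∞) : ⨆ k : ℕ, min a k = a := by
  rw [← inf_iSup_eq, ENNReal.iSup_natCast, inf_top_eq]

lemma mul_rpow_sub_one (a : ℝ≥0∞) {s : ℝ} (hs : 1 ≤ s) : a * a ^ (s - 1) = a ^ s := by
  conv_rhs => rw [← add_sub_cancel 1 s, ENNReal.rpow_add_of_nonneg _ _ zero_le_one
    (sub_nonneg.2 hs), ENNReal.rpow_one]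

lemma lintegral_rpow_eq_lintegral_meas_ofReal_lt_of_ne_top {f : α → ℝ≥0∞} (hf : Measurable f)
    (hft : ∀ x, f x ≠ ∞) {s : ℝ} (hs : 0 < s) :
    ∫⁻ x, f x ^ s ∂μ = ENNReal.ofReal s *
      ∫⁻ t in Ioi (0 : ℝ), μ {x | ENNReal.ofReal t < f x} * ENNReal.ofReal (t ^ (s - 1)) := by
  have h := lintegral_rpow_eq_lintegral_meas_lt_mul μ (f := fun x => (f x).toReal)
    (ae_of_all _ fun x => ENNReal.toReal_nonneg) hf.ennreal_toReal.aemeasurable hs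
  simp only [← ENNReal.ofReal_rpow_of_nonneg ENNReal.toReal_nonneg hs.le,
    ENNReal.ofReal_toReal (hft _)] at h
  rw [h]
  congr 1
  refine setLIntegral_congr_fun measurableSet_Ioi fun t ht => ?_
  simp only [ENNReal.ofReal_lt_iff_lt_toReal (le_of_lt ht) (hft _)]

lemma lintegral_rpow_eq_lintegral_meas_ofReal_lt {f : α → ℝ≥0∞} (hf : Measurable f) {s : ℝ}
    (hs : 0 < s) : ∫⁻ x, f x ^ s ∂μ = ENNReal.ofReal s *
      ∫⁻ t in Ioi (0 : ℝ), μ {x | ENNReal.ofReal t < f x} * ENNReal.ofReal (t ^ (s - 1)) := by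
  have hmono : Monotone fun (k : ℕ) x => min (f x) (k : ℝ≥0∞) := fun j k hjk x =>
    min_le_min le_rfl (by exact_mod_cast hjk)
  have hmeas : ∀ k : ℕ, Measurable fun t : ℝ => μ {x | ENNReal.ofReal t < min (f x) k} := fun k =>
    Antitone.measurable fun t u htu =>
      measure_mono fun x hx => (ENNReal.ofReal_le_ofReal htu).trans_lt hx
  have hmono' : ∀ t : ℝ, Monotone fun k : ℕ => {x | ENNReal.ofReal t < min (f x) k} :=
    fun t j k hjk x hx => lt_of_lt_of_le hx (hmono hjk x)
  have hlevel : ∀ t : ℝ, μ {x | ENNReal.ofReal t < f x} =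
      ⨆ k : ℕ, μ {x | ENNReal.ofReal t < min (f x) k} := fun t => by
    rw [← (hmono' t).measure_iUnion, ← ofPred_exists]
    simp only [← lt_iSup_iff, iSup_min_natCast]
  calc ∫⁻ x, f x ^ s ∂μ = ⨆ k : ℕ, ∫⁻ x, min (f x) k ^ s ∂μ := by
        rw [← lintegral_iSup (fun k => (hf.min measurable_const).pow_const s)
          fun j k hjk x => ENNReal.rpow_le_rpow (hmono hjk x) hs.le]
        simp only [← iSup_rpow _ hs, iSup_min_natCast]
    _ = ⨆ k : ℕ, ENNReal.ofReal s * ∫⁻ t in Ioi (0 : ℝ),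
          μ {x | ENNReal.ofReal t < min (f x) k} * ENNReal.ofReal (t ^ (s - 1)) :=
        iSup_congr fun k => lintegral_rpow_eq_lintegral_meas_ofReal_lt_of_ne_top
          (hf.min measurable_const) (fun x => ne_top_of_le_ne_top (by simp) (min_le_right _ _)) hs
    _ = _ := by
        simp only [hlevel, ENNReal.iSup_mul]
        rw [← ENNReal.mul_iSup, lintegral_iSup
          (f := fun (k : ℕ) (t : ℝ) =>
            μ {x | ENNReal.ofReal t < min (f x) k} * ENNReal.ofReal (t ^ (s - 1)))
          (fun k => (hmeas k).mul (by fun_prop))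
          fun j k hjk t => mul_le_mul_left (measure_mono (hmono' t hjk)) _]

/-- The Marcinkiewicz interpolation step: integrating the bound on the level sets of `M` against
`t ^ (s - 1) dt` gives `∫ G (2 G) ^ (s - 1)` on the right-hand side. -/
lemma lintegral_rpow_le_of_meas_lt_le {M G : α → ℝ≥0∞} (hM : Measurable M) (hG : Measurable G)
    {A : ℝ≥0∞} (hA : A ≠ ∞) (h : ∀ t : ℝ≥0∞, t ≠ 0 → t ≠ ∞ →
      μ {x | t < M x} ≤ A * t⁻¹ * ∫⁻ x in {x | t < 2 * G x}, G x ∂μ) {s : ℝ} (hs : 1 < s) :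
    ∫⁻ x, M x ^ s ∂μ ≤
      ENNReal.ofReal s * A * (ENNReal.ofReal (s - 1))⁻¹ * 2 ^ (s - 1) * ∫⁻ x, G x ^ s ∂μ := by
  set ν := μ.withDensity G with hν
  have h2G : Measurable fun x => 2 * G x := hG.const_mul 2
  have hlevel : ∀ t ∈ Ioi (0 : ℝ), μ {x | ENNReal.ofReal t < M x} * ENNReal.ofReal (t ^ (s - 1)) ≤
      A * (ν {x | ENNReal.ofReal t < 2 * G x} * ENNReal.ofReal (t ^ (s - 1 - 1))) := by
    intro t ht
    have hpow : ENNReal.ofReal (t ^ (s - 1 - 1)) =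
        (ENNReal.ofReal t)⁻¹ * ENNReal.ofReal (t ^ (s - 1)) := by
      rw [Real.rpow_sub_one (ne_of_gt ht), div_eq_inv_mul,
        ENNReal.ofReal_mul (inv_nonneg.2 (le_of_lt ht)), ENNReal.ofReal_inv_of_pos ht]
    rw [hν, withDensity_apply _ (measurableSet_lt measurable_const h2G), hpow]
    refine (mul_le_mul_left (h _ (by simpa using ht) ENNReal.ofReal_ne_top) _).trans_eq ?_
    ac_rfl
  have hν_lint : ∫⁻ x, (2 * G x) ^ (s - 1) ∂ν = 2 ^ (s - 1) * ∫⁻ x, G x ^ s ∂μ := by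
    rw [hν, lintegral_withDensity_eq_lintegral_mul _ hG (h2G.pow_const _),
      ← lintegral_const_mul _ (hG.pow_const _)]
    refine lintegral_congr fun x => ?_
    rw [Pi.mul_apply, ENNReal.mul_rpow_of_nonneg _ _ (by linarith), ← mul_rpow_sub_one _ hs.le]
    ring
  have hs0 : ENNReal.ofReal (s - 1) ≠ 0 := by simpa using hs
  calc ∫⁻ x, M x ^ s ∂μ
      = ENNReal.ofReal s * ∫⁻ t in Ioi (0 : ℝ),
          μ {x | ENNReal.ofReal t < M x} * ENNReal.ofReal (t ^ (s - 1)) :=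
        lintegral_rpow_eq_lintegral_meas_ofReal_lt hM (by linarith)
    _ ≤ ENNReal.ofReal s * ∫⁻ t in Ioi (0 : ℝ), A *
          (ν {x | ENNReal.ofReal t < 2 * G x} * ENNReal.ofReal (t ^ (s - 1 - 1))) :=
        mul_le_mul_right (setLIntegral_mono' measurableSet_Ioi hlevel) _
    _ = ENNReal.ofReal s * A * ((ENNReal.ofReal (s - 1))⁻¹ * ∫⁻ x, (2 * G x) ^ (s - 1) ∂ν) := by
        rw [lintegral_const_mul' _ _ hA, lintegral_rpow_eq_lintegral_meas_ofReal_lt h2G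
          (sub_pos.2 hs), ENNReal.inv_mul_cancel_left' (by simp [hs0]) (by simp), mul_assoc]
    _ = _ := by rw [hν_lint]; ring

lemma lintegral_rpow_le_lintegral_rpow [IsProbabilityMeasure μ] {f : α → ℝ≥0∞}
    (hf : AEMeasurable f μ) {u : ℝ} (hu : 1 ≤ u) : (∫⁻ x, f x ∂μ) ^ u ≤ ∫⁻ x, f x ^ u ∂μ := by
  have h := eLpNorm'_le_eLpNorm'_of_exponent_le one_pos hu μ hf.aestronglyMeasurable
  simp only [eLpNorm', enorm_eq_self, ENNReal.rpow_one, one_div, inv_one] at h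
  exact (ENNReal.le_rpow_inv_iff (by linarith)).1 h

lemma laverage_rpow_le_laverage_rpow [IsFiniteMeasure μ] [NeZero μ] {f : α → ℝ≥0∞}
    (hf : AEMeasurable f μ) {u : ℝ} (hu : 1 ≤ u) : (⨍⁻ x, f x ∂μ) ^ u ≤ ⨍⁻ x, f x ^ u ∂μ :=
  lintegral_rpow_le_lintegral_rpow (hf.smul_measure _) hu

end Lintegral

section MaximalFunction

/-- The Hardy–Littlewood maximal function of `G` over the balls of `ℚ_p^n`. -/
noncomputable def maximalFunction (G : Qpn p n → ℝ≥0∞) (x : Qpn p n) : ℝ≥0∞ :=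
  ⨆ γ : ℤ, ⨍⁻ y in pBall γ x, G y ∂(haar p n)

lemma laverage_pBall_le_maximalFunction (G : Qpn p n → ℝ≥0∞) (γ : ℤ) (x : Qpn p n) :
    ⨍⁻ y in pBall γ x, G y ∂(haar p n) ≤ maximalFunction G x :=
  le_iSup (fun γ => ⨍⁻ y in pBall γ x, G y ∂(haar p n)) γ

lemma measurable_laverage_pBall {F : Qpn p n → Qpn p n → ℝ≥0∞}
    (hF : Measurable (Function.uncurry F)) (γ : ℤ) :
    Measurable fun x => ⨍⁻ y in pBall γ x, F x y ∂(haar p n) := by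
  have hball : MeasurableSet {z : Qpn p n × Qpn p n | dist z.2 z.1 ≤ (p : ℝ) ^ γ} :=
    (isClosed_le (by fun_prop) continuous_const).measurableSet
  have h := (hF.indicator hball).lintegral_prod_right' (ν := haar p n)
  simp only [setLAverage_eq, haar_pBall, ← lintegral_indicator (measurableSet_pBall _ _)]
  exact h.div_const _

lemma measurable_maximalFunction {G : Qpn p n → ℝ≥0∞} (hG : Measurable G) :
    Measurable (maximalFunction G) :=
  Measurable.iSup fun γ =>
    measurable_laverage_pBall (F := fun _ y => G y) (hG.comp measurable_snd) γ

lemma exists_forall_le_of_haar_pBall_le (hn : n ≠ 0) {A : ℝ≥0∞} (hA : A ≠ ∞) :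
    ∃ N : ℤ, ∀ (γ : ℤ) (x : Qpn p n), haar p n (pBall γ x) ≤ A → γ ≤ N := by
  obtain ⟨N, hN⟩ := ENNReal.exists_nat_gt hA
  refine ⟨N, fun γ x hγ => le_of_not_gt fun hNγ => (hN.trans_le ?_).not_ge hγ⟩
  have hn1 : (1 : ℝ) ≤ n := by exact_mod_cast Nat.one_le_iff_ne_zero.2 hn
  have hNγ' : (N : ℝ) ≤ γ := by exact_mod_cast hNγ.le
  calc (N : ℝ≥0∞) ≤ (p : ℝ≥0∞) ^ N := by
        exact_mod_cast (Nat.lt_pow_self (Fact.out : p.Prime).one_lt).le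
    _ = (p : ℝ≥0∞) ^ (N : ℝ) := (ENNReal.rpow_natCast _ _).symm
    _ ≤ (p : ℝ≥0∞) ^ ((n : ℝ) * γ) :=
        ENNReal.rpow_le_rpow_of_exponent_le (one_le_prime p) (by nlinarith [N.cast_nonneg (α := ℝ)])
    _ = haar p n (pBall γ x) := (haar_pBall γ x).symm

/-- Two balls that meet are nested, so that Vitali's covering needs no enlargement: a factor
`3 / 2 < p` in the comparison of the radii already forces them to be ordered. -/
lemma exists_pairwiseDisjoint_pBall_cover (T : Set (Qpn p n × ℤ)) {N : ℤ} (hT : ∀ a ∈ T, a.2 ≤ N) :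
    ∃ u ⊆ T, u.PairwiseDisjoint (fun a => pBall a.2 a.1) ∧
      ∀ a ∈ T, ∃ b ∈ u, pBall a.2 a.1 ⊆ pBall b.2 b.1 := by
  obtain ⟨u, huT, hdisj, hcov⟩ := Vitali.exists_disjoint_subfamily_covering_enlargement
    (fun a : Qpn p n × ℤ => pBall a.2 a.1) T (fun a => (p : ℝ) ^ a.2) (3 / 2) (by norm_num)
    (fun a _ => zpow_nonneg (prime_pos p).le _) ((p : ℝ) ^ N)
    (fun a ha => zpow_le_zpow_right₀ (one_lt_prime p).le (hT a ha))
    (fun a _ => ⟨a.1, mem_pBall_self _ _⟩)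
  refine ⟨u, huT, hdisj, fun a ha => ?_⟩
  obtain ⟨b, hb, ⟨y, hya, hyb⟩, hab⟩ := hcov a ha
  have hle : a.2 ≤ b.2 := by
    by_contra! hlt
    have h2p : (2 : ℝ) ≤ p := by exact_mod_cast (Fact.out : p.Prime).two_le
    have hpow : (p : ℝ) ^ b.2 * p ≤ (p : ℝ) ^ a.2 := by
      rw [← zpow_add_one₀ (prime_pos p).ne']
      exact zpow_le_zpow_right₀ (one_lt_prime p).le hlt
    nlinarith [zpow_pos (prime_pos p) b.2]
  refine ⟨b, hb, ?_⟩
  rw [← pBall_eq_of_mem hya, ← pBall_eq_of_mem hyb]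
  exact pBall_mono hle y

lemma haar_lt_maximalFunction_le (hn : n ≠ 0) (G : Qpn p n → ℝ≥0∞) {t : ℝ≥0∞} (ht : t ≠ 0)
    (ht' : t ≠ ∞) :
    haar p n {x | t < maximalFunction G x} ≤ t⁻¹ * ∫⁻ y, G y ∂(haar p n) := by
  by_cases hG : ∫⁻ y, G y ∂(haar p n) = ∞
  · rw [hG, ENNReal.mul_top (ENNReal.inv_ne_zero.2 ht')]
    exact le_top
  let T : Set (Qpn p n × ℤ) :=
    {a | haar p n (pBall a.2 a.1) ≤ t⁻¹ * ∫⁻ y in pBall a.2 a.1, G y ∂(haar p n)}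
  obtain ⟨N, hN⟩ := exists_forall_le_of_haar_pBall_le (p := p) hn
    (ENNReal.mul_ne_top (ENNReal.inv_ne_top.2 ht) hG)
  obtain ⟨u, huT, hdisj, hcov⟩ := exists_pairwiseDisjoint_pBall_cover T fun a ha =>
    hN a.2 a.1 (ha.trans (mul_le_mul_right (setLIntegral_le_lintegral _ _) _))
  have hu : u.Countable := hdisj.countable_of_nonempty_interior fun a _ =>
    ⟨a.1, ball_subset_interior_closedBall (mem_ball_self (zpow_pos (prime_pos p) _))⟩
  have hsub : {x | t < maximalFunction G x} ⊆ ⋃ a ∈ u, pBall a.2 a.1 := by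
    intro x hx
    obtain ⟨γ, hγ⟩ := lt_iSup_iff.1 (show t < ⨆ γ, _ from hx)
    have hxγ : (x, γ) ∈ T := by
      rw [setLAverage_eq] at hγ
      change haar p n (pBall γ x) ≤ t⁻¹ * ∫⁻ y in pBall γ x, G y ∂(haar p n)
      rw [← ENNReal.div_eq_inv_mul, ENNReal.le_div_iff_mul_le (.inl ht) (.inl ht'),
        mul_comm]
      exact (ENNReal.mul_lt_of_lt_div hγ).le
    obtain ⟨a, ha, hsub⟩ := hcov _ hxγ
    exact mem_iUnion₂.2 ⟨a, ha, hsub (mem_pBall_self γ x)⟩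
  calc haar p n {x | t < maximalFunction G x}
      ≤ haar p n (⋃ a ∈ u, pBall a.2 a.1) := measure_mono hsub
    _ ≤ ∑' a : u, haar p n (pBall a.1.2 a.1.1) := measure_biUnion_le _ hu _
    _ ≤ ∑' a : u, t⁻¹ * ∫⁻ y in pBall a.1.2 a.1.1, G y ∂(haar p n) :=
        ENNReal.tsum_le_tsum fun a => huT a.2
    _ = t⁻¹ * ∫⁻ y in ⋃ a ∈ u, pBall a.2 a.1, G y ∂(haar p n) := by
        rw [ENNReal.tsum_mul_left,
          lintegral_biUnion hu (fun a _ => measurableSet_pBall _ _) hdisj]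
    _ ≤ t⁻¹ * ∫⁻ y, G y ∂(haar p n) := mul_le_mul_right (setLIntegral_le_lintegral _ _) _

lemma maximalFunction_le_add_const {G H : Qpn p n → ℝ≥0∞} {c : ℝ≥0∞} (h : ∀ y, G y ≤ H y + c)
    (x : Qpn p n) : maximalFunction G x ≤ maximalFunction H x + c := by
  refine iSup_le fun γ => ?_
  calc ⨍⁻ y in pBall γ x, G y ∂(haar p n)
      ≤ ⨍⁻ y in pBall γ x, (H y + c) ∂(haar p n) := laverage_mono_ae (ae_of_all _ h)
    _ = (⨍⁻ y in pBall γ x, H y ∂(haar p n)) + c := by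
        rw [setLAverage_eq, setLAverage_eq, lintegral_add_right _ measurable_const,
          setLIntegral_const, ENNReal.add_div, ENNReal.mul_div_cancel_right
            (haar_pBall_ne_zero γ x) (haar_pBall_ne_top γ x)]
    _ ≤ maximalFunction H x + c := by
        gcongr
        exact laverage_pBall_le_maximalFunction H γ x

lemma haar_lt_maximalFunction_le_setLIntegral (hn : n ≠ 0) {G : Qpn p n → ℝ≥0∞}
    (hG : Measurable G) {t : ℝ≥0∞} (ht : t ≠ 0) (ht' : t ≠ ∞) :
    haar p n {x | t < maximalFunction G x} ≤
      2 * t⁻¹ * ∫⁻ y in {y | t < 2 * G y}, G y ∂(haar p n) := by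
  set S := {y | t < 2 * G y}
  have hGS : ∀ y, G y ≤ S.indicator G y + t / 2 := fun y => by
    by_cases hy : y ∈ S
    · rw [indicator_of_mem hy]
      exact le_self_add
    · refine le_add_left ((ENNReal.le_div_iff_mul_le (by simp) (by simp)).2 ?_)
      rw [mul_comm]
      exact not_lt.1 hy
  have hsub : {x | t < maximalFunction G x} ⊆ {x | t / 2 < maximalFunction (S.indicator G) x} := by
    intro x hx
    by_contra h
    refine (lt_of_lt_of_le hx (maximalFunction_le_add_const hGS x)).not_ge ?_
    calc maximalFunction (S.indicator G) x + t / 2 ≤ t / 2 + t / 2 := by gcongr; exact not_lt.1 h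
      _ = t := ENNReal.add_halves t
  refine (measure_mono hsub).trans ((haar_lt_maximalFunction_le hn _ (by simpa using ht)
    (ENNReal.div_ne_top ht' (by simp))).trans_eq ?_)
  rw [lintegral_indicator (measurableSet_lt measurable_const (hG.const_mul 2)),
    ENNReal.inv_div (by simp) (by simp), div_eq_mul_inv]

lemma exists_lintegral_maximalFunction_rpow_le (hn : n ≠ 0) {s : ℝ} (hs : 1 < s) :
    ∃ C : ℝ≥0, ∀ G : Qpn p n → ℝ≥0∞, Measurable G →
      ∫⁻ x, maximalFunction G x ^ s ∂(haar p n) ≤ C * ∫⁻ x, G x ^ s ∂(haar p n) := by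
  have hC : ENNReal.ofReal s * 2 * (ENNReal.ofReal (s - 1))⁻¹ * 2 ^ (s - 1) ≠ ∞ := by
    refine ENNReal.mul_ne_top (ENNReal.mul_ne_top (by finiteness) ?_)
      (ENNReal.rpow_ne_top_of_nonneg (by linarith) (by simp))
    simpa using hs
  refine ⟨(ENNReal.ofReal s * 2 * (ENNReal.ofReal (s - 1))⁻¹ * 2 ^ (s - 1)).toNNReal,
    fun G hG => ?_⟩
  rw [ENNReal.coe_toNNReal hC]
  exact lintegral_rpow_le_of_meas_lt_le (measurable_maximalFunction hG) hG (by simp)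
    (fun t ht ht' => haar_lt_maximalFunction_le_setLIntegral hn hG ht ht') hs

end MaximalFunction

section DecayComparison

lemma one_le_logb_add_norm (y : Qpn p n) : 1 ≤ Real.logb p (p + ‖y‖) := by
  rw [Real.le_logb_iff_rpow_le (one_lt_prime p)
    (add_pos_of_pos_of_nonneg (prime_pos p) (norm_nonneg y)), Real.rpow_one]
  exact le_add_of_nonneg_right (norm_nonneg y)

lemma decayWeight_eq_rpow (y : Qpn p n) :
    decayWeight y = (p : ℝ≥0∞) ^ (-((n + 1) * Real.logb p (p + ‖y‖))) := by
  have hy : 0 < (p : ℝ) + ‖y‖ := add_pos_of_pos_of_nonneg (prime_pos p) (norm_nonneg y)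
  rw [← ENNReal.ofReal_natCast p, ENNReal.ofReal_rpow_of_pos (prime_pos p), decayWeight,
    neg_mul_eq_neg_mul, mul_comm, Real.rpow_mul (prime_pos p).le,
    Real.rpow_logb (prime_pos p) (one_lt_prime p).ne' hy]

/-- If `t` exceeds a suitable power of the decay weight, then `t ^ (a - b)` is bounded; otherwise
`t ^ a` is at most the decay weight. -/
lemma rpow_le_mul_rpow_add_decayWeight {t : ℝ≥0∞} (ht : t ≤ 1) {a₀ a b C : ℝ} (ha₀ : 0 < a₀)
    (ha : a₀ ≤ a) (hC : 0 ≤ C) (y : Qpn p n) (hab : |a - b| ≤ C / Real.logb p (p + ‖y‖)) :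
    t ^ a ≤ (p : ℝ≥0∞) ^ ((n + 1) * C / a₀) * t ^ b + decayWeight y := by
  set l := Real.logb p (p + ‖y‖)
  have hl : 1 ≤ l := one_le_logb_add_norm y
  set w : ℝ≥0∞ := (p : ℝ≥0∞) ^ (-((n + 1) * l / a₀)) with hw
  rcases le_total t w with htw | hwt
  · refine le_add_left ((ENNReal.rpow_le_rpow htw (ha₀.le.trans ha)).trans ?_)
    rw [decayWeight_eq_rpow, hw, ← ENNReal.rpow_mul]
    refine ENNReal.rpow_le_rpow_of_exponent_le (one_le_prime p) ?_
    rw [neg_mul, neg_le_neg_iff, div_mul_eq_mul_div, le_div_iff₀ ha₀]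
    exact mul_le_mul_of_nonneg_left ha (by positivity)
  · have ht0 : t ≠ 0 := ((pos_iff_ne_zero.2 (prime_rpow_ne_zero p _)).trans_le hwt).ne'
    have ht' : t ≠ ∞ := (ht.trans_lt ENNReal.one_lt_top).ne
    have hbound : t ^ (a - b) ≤ (p : ℝ≥0∞) ^ ((n + 1) * C / a₀) :=
      calc t ^ (a - b) ≤ t ^ (-(C / l)) :=
            ENNReal.rpow_le_rpow_of_exponent_ge ht (by linarith [neg_abs_le (a - b)])
        _ ≤ w ^ (-(C / l)) := by
            rw [ENNReal.rpow_neg, ENNReal.rpow_neg, ENNReal.inv_le_inv]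
            exact ENNReal.rpow_le_rpow hwt (by positivity)
        _ = (p : ℝ≥0∞) ^ ((n + 1) * C / a₀) := by
            rw [hw, ← ENNReal.rpow_mul]
            congr 1
            field_simp
    calc t ^ a = t ^ (a - b) * t ^ b := by rw [← ENNReal.rpow_add _ _ ht0 ht', sub_add_cancel]
      _ ≤ (p : ℝ≥0∞) ^ ((n + 1) * C / a₀) * t ^ b := mul_le_mul_left hbound _
      _ ≤ _ := le_self_add

lemma rpow_le_mul_add_decayWeight_of_le {t K : ℝ≥0∞} (htK : t ≤ K) (hK : 1 ≤ K) (hK' : K ≠ ∞)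
    {a₀ a C : ℝ} (ha₀ : 0 < a₀) (ha : a₀ ≤ a) (hC : 0 ≤ C) (y : Qpn p n)
    (hab : |a - 1| ≤ C / Real.logb p (p + ‖y‖)) :
    t ^ a ≤ K ^ a * (p : ℝ≥0∞) ^ ((n + 1) * C / a₀) * (t + decayWeight y) := by
  have hK0 : K ≠ 0 := (one_pos.trans_le hK).ne'
  set c : ℝ≥0∞ := (p : ℝ≥0∞) ^ ((n + 1) * C / a₀)
  have hc : 1 ≤ c := by
    rw [← ENNReal.rpow_zero]
    exact ENNReal.rpow_le_rpow_of_exponent_le (one_le_prime p) (by positivity)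
  calc t ^ a = K ^ a * (t / K) ^ a := by
        rw [← ENNReal.mul_rpow_of_nonneg _ _ (ha₀.le.trans ha), ENNReal.mul_div_cancel hK0 hK']
    _ ≤ K ^ a * (c * (t / K) + decayWeight y) := by
        gcongr
        simpa only [ENNReal.rpow_one] using rpow_le_mul_rpow_add_decayWeight
          (ENNReal.div_le_of_le_mul (by rwa [one_mul])) ha₀ ha hC y hab
    _ ≤ K ^ a * (c * t + c * decayWeight y) := by
        gcongr
        · exact ENNReal.div_le_of_le_mul (le_mul_of_one_le_right' hK)
        · exact le_mul_of_one_le_left' hc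
    _ = K ^ a * c * (t + decayWeight y) := by ring

end DecayComparison

section IsExponent

variable {r : Qpn p n → ℝ}

lemma IsExponent.mem_Icc (hr : IsExponent r) (y : Qpn p n) :
    r y ∈ Icc (essInf r (haar p n)) (essSup r (haar p n)) :=
  ⟨hr.essInf_le y, hr.le_essSup y⟩

lemma IsExponent.one_lt (hr : IsExponent r) (y : Qpn p n) : 1 < r y :=
  hr.one_lt_essInf.trans_le (hr.essInf_le y)

lemma IsExponent.isBoundedUnder_ge (hr : IsExponent r) (ν : Measure (Qpn p n)) :
    IsBoundedUnder (· ≥ ·) (ae ν) r :=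
  isBoundedUnder_of ⟨_, hr.essInf_le⟩

lemma IsExponent.isBoundedUnder_le (hr : IsExponent r) (ν : Measure (Qpn p n)) :
    IsBoundedUnder (· ≤ ·) (ae ν) r :=
  isBoundedUnder_of ⟨_, hr.le_essSup⟩

lemma IsExponent.ae_mem_Icc_essInf_essSup (hr : IsExponent r) (ν : Measure (Qpn p n)) :
    ∀ᵐ y ∂ν, r y ∈ Icc (essInf r ν) (essSup r ν) :=
  (ae_essInf_le (hr.isBoundedUnder_ge ν)).and (ae_le_essSup (hr.isBoundedUnder_le ν))

lemma IsExponent.essInf_mem_Icc (hr : IsExponent r) (ν : Measure (Qpn p n)) [NeZero ν] :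
    essInf r ν ∈ Icc (essInf r (haar p n)) (essSup r (haar p n)) := by
  obtain ⟨y, hy⟩ := (hr.ae_mem_Icc_essInf_essSup ν).exists
  exact ⟨le_essInf_of_ae_le _ (ae_of_all _ hr.essInf_le)
    (hr.isBoundedUnder_le ν).isCoboundedUnder_ge, hy.1.trans (hr.le_essSup y)⟩

end IsExponent

section IsLogHolder

variable {r : Qpn p n → ℝ}

lemma IsLogHolder.exists_local (hr : IsLogHolder r) : ∃ C : ℝ, 0 ≤ C ∧ ∀ (γ : ℤ) (a : Qpn p n),
    ∀ᵐ y ∂((haar p n).restrict (pBall γ a)),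
      essInf r ((haar p n).restrict (pBall γ a)) ≤ r y ∧
        -(γ : ℝ) * (r y - essInf r ((haar p n).restrict (pBall γ a))) ≤ C := by
  obtain ⟨C, hC⟩ := hr.local_cond
  refine ⟨max C 0, le_max_right _ _, fun γ a => ?_⟩
  filter_upwards [hr.isExponent.ae_mem_Icc_essInf_essSup _] with y hy
  refine ⟨hy.1, ?_⟩
  rcases le_total γ 0 with hγ | hγ
  · have hγ' : (γ : ℝ) ≤ 0 := by exact_mod_cast hγ
    exact le_max_of_le_left ((by nlinarith [hy.2] : _ ≤ _).trans (hC γ a))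
  · have hγ' : (0 : ℝ) ≤ γ := by exact_mod_cast hγ
    exact le_max_of_le_right (by nlinarith [hy.1])

lemma exists_norm_eq_pow (hn : n ≠ 0) (k : ℕ) : ∃ x : Qpn p n, ‖x‖ = (p : ℝ) ^ k := by
  have : NeZero n := ⟨hn⟩
  exact ⟨fun _ => (p : ℚ_[p]) ^ (-(k : ℤ)), by
    rw [pi_norm_const, Padic.norm_p_zpow, neg_neg, zpow_natCast]⟩

lemma IsLogHolder.exists_atInfinity (hn : n ≠ 0) (hr : IsLogHolder r) :
    ∃ C : ℝ, 0 ≤ C ∧ ∃ r₀ ∈ Icc (essInf r (haar p n)) (essSup r (haar p n)),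
      ∀ y, |r y - r₀| ≤ C / Real.logb p (p + ‖y‖) := by
  obtain ⟨C, hC⟩ := hr.infinity_cond
  choose x hx using exists_norm_eq_pow (p := p) hn
  obtain ⟨r₀, hr₀, φ, hφ, hlim⟩ :=
    isCompact_Icc.tendsto_subseq fun k => hr.isExponent.mem_Icc (x k)
  have hbound : ∀ y, |r y - r₀| ≤ C / Real.logb p (p + ‖y‖) := by
    intro y
    refine le_of_tendsto (tendsto_const_nhds.sub hlim).abs ?_
    obtain ⟨N, hN⟩ := pow_unbounded_of_one_lt ‖y‖ (one_lt_prime p)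
    filter_upwards [eventually_ge_atTop N] with k hk
    have hxk : ‖y‖ ≤ ‖x (φ k)‖ := by
      rw [hx]
      exact hN.le.trans (pow_le_pow_right₀ (one_lt_prime p).le (hk.trans (hφ.id_le k)))
    exact (hC y (x (φ k))).trans_eq (by rw [min_eq_left hxk])
  have hC0 : 0 ≤ C := by
    have h := (abs_nonneg _).trans (hbound 0)
    rwa [le_div_iff₀ (one_pos.trans_le (one_le_logb_add_norm 0)), zero_mul] at h
  exact ⟨C, hC0, r₀, hr₀, hbound⟩

lemma ae_forall_pBall {P : Set (Qpn p n) → ℤ → Qpn p n → Prop}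
    (h : ∀ γ a, ∀ᵐ y ∂((haar p n).restrict (pBall γ a)), P (pBall γ a) γ y) :
    ∀ᵐ x ∂(haar p n), ∀ γ, P (pBall γ x) γ x := by
  obtain ⟨D, hDc, hD⟩ := TopologicalSpace.exists_countable_dense (Qpn p n)
  have hae : ∀ᵐ x ∂(haar p n), ∀ γ : ℤ, ∀ d ∈ D, x ∈ pBall γ d → P (pBall γ d) γ x :=
    ae_all_iff.2 fun γ => (ae_ball_iff hDc).2 fun d _ =>
      (ae_restrict_iff' (measurableSet_pBall γ d)).1 (h γ d)
  filter_upwards [hae] with x hx γ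
  obtain ⟨d, hd, hdx⟩ := hD.exists_dist_lt x (zpow_pos (prime_pos p) γ)
  have hmem : x ∈ pBall γ d := hdx.le
  exact pBall_eq_of_mem hmem ▸ hx γ d hd hmem

end IsLogHolder

section IsRefExponent

/-- A number `q₀` by which the exponent `q` may be replaced in the computation of the norm of the
indicator function of the ball `B_γ(a)`: a value of `q` on a small ball, or the value of `q` at
infinity for a large ball. -/
def IsRefExponent (C : ℝ) (γ : ℤ) (a : Qpn p n) (q : Qpn p n → ℝ) (q₀ : ℝ) : Prop :=
  (γ ≤ 0 ∧ ∀ᵐ y ∂((haar p n).restrict (pBall γ a)), -(γ : ℝ) * |q y - q₀| ≤ C) ∨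
    (0 ≤ γ ∧ ∀ y, |q y - q₀| ≤ C / Real.logb p (p + ‖y‖))

variable {C : ℝ} {γ : ℤ} {a : Qpn p n} {q : Qpn p n → ℝ} {q₀ : ℝ}

lemma IsRefExponent.of_abs_sub_le {L : ℝ} {q' : Qpn p n → ℝ} {q₀' : ℝ}
    (h : IsRefExponent C γ a q q₀) (hL : 0 ≤ L) (hq : ∀ y, |q' y - q₀'| ≤ L * |q y - q₀|) :
    IsRefExponent (L * C) γ a q' q₀' := by
  refine h.imp (fun ⟨hγ, h⟩ => ⟨hγ, h.mono fun y hy => ?_⟩) fun ⟨hγ, h⟩ => ⟨hγ, fun y => ?_⟩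
  · have hγ' : (γ : ℝ) ≤ 0 := by exact_mod_cast hγ
    calc -(γ : ℝ) * |q' y - q₀'| ≤ -(γ : ℝ) * (L * |q y - q₀|) :=
          mul_le_mul_of_nonneg_left (hq y) (neg_nonneg.2 hγ')
      _ = L * (-(γ : ℝ) * |q y - q₀|) := by ring
      _ ≤ L * C := mul_le_mul_of_nonneg_left hy hL
  · rw [mul_div_assoc]
    exact (hq y).trans (mul_le_mul_of_nonneg_left (h y) hL)

lemma IsLogHolder.exists_isRefExponent (hn : n ≠ 0) {r : Qpn p n → ℝ} (hr : IsLogHolder r) :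
    ∃ C : ℝ, 0 ≤ C ∧ ∀ (γ : ℤ) (a : Qpn p n),
      ∃ r₀ ∈ Icc (essInf r (haar p n)) (essSup r (haar p n)), IsRefExponent C γ a r r₀ := by
  obtain ⟨C₁, hC₁, hloc⟩ := hr.exists_local
  obtain ⟨C₂, -, r₀, hr₀, hinf⟩ := hr.exists_atInfinity hn
  refine ⟨max C₁ C₂, le_max_of_le_left hC₁, fun γ a => ?_⟩
  rcases le_total γ 0 with hγ | hγ
  · refine ⟨_, hr.isExponent.essInf_mem_Icc ((haar p n).restrict (pBall γ a)),
      Or.inl ⟨hγ, (hloc γ a).mono fun y hy => ?_⟩⟩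
    rw [abs_of_nonneg (sub_nonneg.2 hy.1)]
    exact hy.2.trans (le_max_left _ _)
  · refine ⟨r₀, hr₀, Or.inr ⟨hγ, fun y => (hinf y).trans ?_⟩⟩
    have := one_le_logb_add_norm y
    gcongr
    exact le_max_right _ _

lemma setLIntegral_pBall_const_mul_rpow (c : ℝ≥0∞) (γ : ℤ) (a : Qpn p n) :
    ∫⁻ _ in pBall γ a, c * (p : ℝ≥0∞) ^ (-(n * γ : ℝ)) ∂(haar p n) = c := by
  rw [setLIntegral_const, haar_pBall, mul_assoc, ← prime_rpow_add, neg_add_cancel,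
    ENNReal.rpow_zero, mul_one]

lemma rpow_rpow_le_of_neg_mul_le {lo t t₀ : ℝ} (hlo : 0 < lo) (ht₀ : lo ≤ t₀) (hC : 0 ≤ C)
    (h : -(γ : ℝ) * (t - t₀) ≤ C) :
    ((p : ℝ≥0∞) ^ (-(n * γ / t₀))) ^ t ≤
      (p : ℝ≥0∞) ^ ((n + 1) * C / lo) * (p : ℝ≥0∞) ^ (-(n * γ : ℝ)) := by
  rw [← ENNReal.rpow_mul, ← prime_rpow_add]
  refine ENNReal.rpow_le_rpow_of_exponent_le (one_le_prime p) ?_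
  have ht₀' : 0 < t₀ := hlo.trans_le ht₀
  calc -(n * γ / t₀) * t = n * (-(γ : ℝ) * (t - t₀)) / t₀ + -(n * γ : ℝ) := by
        field_simp
        ring
    _ ≤ n * C / lo + -(n * γ : ℝ) := by gcongr
    _ ≤ (n + 1) * C / lo + -(n * γ : ℝ) := by
        gcongr
        linarith

lemma IsRefExponent.setLIntegral_rpow_le (href : IsRefExponent C γ a q q₀) {lo : ℝ} (hlo : 0 < lo)
    (hC : 0 ≤ C) (hq : ∀ y, lo ≤ q y) (hq₀ : lo ≤ q₀) :
    ∫⁻ y in pBall γ a, ((p : ℝ≥0∞) ^ (-(n * γ / q₀))) ^ q y ∂(haar p n) ≤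
      (p : ℝ≥0∞) ^ ((n + 1) * C / lo) + ∫⁻ y, decayWeight (p := p) (n := n) y ∂(haar p n) := by
  set c : ℝ≥0∞ := (p : ℝ≥0∞) ^ ((n + 1) * C / lo)
  rcases href with ⟨hγ, h⟩ | ⟨hγ, h⟩
  · have hγ' : (γ : ℝ) ≤ 0 := by exact_mod_cast hγ
    calc ∫⁻ y in pBall γ a, ((p : ℝ≥0∞) ^ (-(n * γ / q₀))) ^ q y ∂(haar p n)
        ≤ ∫⁻ _ in pBall γ a, c * (p : ℝ≥0∞) ^ (-(n * γ : ℝ)) ∂(haar p n) :=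
          lintegral_mono_ae <| h.mono fun y hy => rpow_rpow_le_of_neg_mul_le hlo hq₀ hC <|
            (mul_le_mul_of_nonneg_left (le_abs_self _) (neg_nonneg.2 hγ')).trans hy
      _ = c := setLIntegral_pBall_const_mul_rpow c γ a
      _ ≤ _ := le_self_add
  · have : (0 : ℝ) ≤ γ := by exact_mod_cast hγ
    have hq₀' : 0 < q₀ := hlo.trans_le hq₀
    have ht : (p : ℝ≥0∞) ^ (-(n * γ / q₀)) ≤ 1 := by
      rw [← ENNReal.rpow_zero]
      exact ENNReal.rpow_le_rpow_of_exponent_le (one_le_prime p) (neg_nonpos.2 (by positivity))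
    have hpow : ((p : ℝ≥0∞) ^ (-(n * γ / q₀))) ^ q₀ = (p : ℝ≥0∞) ^ (-(n * γ : ℝ)) := by
      rw [← ENNReal.rpow_mul, neg_mul, div_mul_cancel₀ _ hq₀'.ne']
    calc ∫⁻ y in pBall γ a, ((p : ℝ≥0∞) ^ (-(n * γ / q₀))) ^ q y ∂(haar p n)
        ≤ ∫⁻ y in pBall γ a, (c * (p : ℝ≥0∞) ^ (-(n * γ : ℝ)) + decayWeight y) ∂(haar p n) :=
          lintegral_mono fun y =>
            hpow ▸ rpow_le_mul_rpow_add_decayWeight ht hlo (hq y) hC y (h y)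
      _ ≤ c + ∫⁻ y, decayWeight (p := p) (n := n) y ∂(haar p n) := by
          rw [lintegral_add_right _ measurable_decayWeight, setLIntegral_pBall_const_mul_rpow]
          gcongr
          exact Measure.restrict_le_self

end IsRefExponent

section Sobolev

/-- The Sobolev-type exponent `q` with `1 / q = 1 / t - α`. -/
noncomputable def sobolevExponent (α t : ℝ) : ℝ := (1 / t - α)⁻¹

variable {α R t u : ℝ}

lemma measurable_sobolevExponent : Measurable (sobolevExponent α) :=
  ((measurable_id.const_div 1).sub_const α).inv

lemma one_div_sobolevExponent (α t : ℝ) : 1 / sobolevExponent α t = 1 / t - α := by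
  rw [sobolevExponent, one_div, inv_inv]

lemma sobolevExponent_pos (h : α < 1 / t) : 0 < sobolevExponent α t :=
  inv_pos.2 (sub_pos.2 h)

lemma le_sobolevExponent (hα : 0 ≤ α) (ht : 0 < t) (h : α < 1 / t) : t ≤ sobolevExponent α t := by
  rw [sobolevExponent, le_inv_comm₀ ht (sub_pos.2 h), ← one_div]
  exact sub_le_self _ hα

lemma sobolevExponent_le_sobolevExponent (ht : 0 < t) (htu : t ≤ u) (h : α < 1 / u) :
    sobolevExponent α t ≤ sobolevExponent α u :=
  inv_anti₀ (sub_pos.2 h) (sub_le_sub_right (one_div_le_one_div_of_le ht htu) α)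

lemma sobolevExponent_sub_sobolevExponent (ht : 0 < t) (hu : 0 < u) (htα : α < 1 / t)
    (huα : α < 1 / u) : sobolevExponent α t - sobolevExponent α u =
      sobolevExponent α t * sobolevExponent α u * ((t - u) / (t * u)) := by
  have hdiff : (t - u) / (t * u) = (1 / u - α) - (1 / t - α) := by
    field_simp
    ring
  have ht' := sub_pos.2 htα
  have hu' := sub_pos.2 huα
  rw [hdiff, sobolevExponent, sobolevExponent]
  generalize 1 / t - α = x at *
  generalize 1 / u - α = y at *
  field_simp

lemma abs_sobolevExponent_sub_le (ht : 1 ≤ t) (hu : 1 ≤ u) (htR : t ≤ R) (huR : u ≤ R)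
    (hR : α < 1 / R) :
    |sobolevExponent α t - sobolevExponent α u| ≤ sobolevExponent α R ^ 2 * |t - u| := by
  have ht0 : 0 < t := by linarith
  have hu0 : 0 < u := by linarith
  have htα : α < 1 / t := hR.trans_le (one_div_le_one_div_of_le ht0 htR)
  have huα : α < 1 / u := hR.trans_le (one_div_le_one_div_of_le hu0 huR)
  have hqt := sobolevExponent_pos htα
  have hqu := sobolevExponent_pos huα
  have hqR := sobolevExponent_pos hR
  rw [sobolevExponent_sub_sobolevExponent ht0 hu0 htα huα, abs_mul, abs_div,
    abs_of_pos (mul_pos hqt hqu), abs_of_pos (mul_pos ht0 hu0), sq]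
  gcongr
  · exact sobolevExponent_le_sobolevExponent ht0 htR hR
  · exact sobolevExponent_le_sobolevExponent hu0 huR hR
  · exact div_le_self (abs_nonneg _) (one_le_mul_of_one_le_of_one_le ht hu)

lemma abs_conjExponent_sub_le {s t u : ℝ} (hs : 1 < s) (ht : s ≤ t) (hu : s ≤ u) :
    |t.conjExponent - u.conjExponent| ≤ ((s - 1) ^ 2)⁻¹ * |t - u| := by
  have : 0 < s - 1 := by linarith
  have ht' : 0 < t - 1 := by linarith
  have hu' : 0 < u - 1 := by linarith
  have hdiff : t.conjExponent - u.conjExponent = ((t - 1) * (u - 1))⁻¹ * (u - t) := by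
    rw [Real.conjExponent, Real.conjExponent]
    field_simp
    ring
  rw [hdiff, abs_mul, abs_of_pos (inv_pos.2 (mul_pos ht' hu')), abs_sub_comm u t, sq]
  gcongr

end Sobolev

section FractionalMaximal

/-- The fractional maximal function `sup_γ |B_γ(x)|^α ⨍_{B_γ(x)} G`; a Lipschitz function of order
`β` has a maximal commutator dominated by it with `α = β / n`. -/
noncomputable def fractionalMaximal (α : ℝ) (G : Qpn p n → ℝ≥0∞) (x : Qpn p n) : ℝ≥0∞ :=
  ⨆ γ : ℤ, haar p n (pBall γ x) ^ α * ⨍⁻ y in pBall γ x, G y ∂(haar p n)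

variable {α : ℝ}

lemma le_fractionalMaximal (G : Qpn p n → ℝ≥0∞) (γ : ℤ) (x : Qpn p n) :
    haar p n (pBall γ x) ^ α * ⨍⁻ y in pBall γ x, G y ∂(haar p n) ≤ fractionalMaximal α G x :=
  le_iSup (fun γ : ℤ => haar p n (pBall γ x) ^ α * ⨍⁻ y in pBall γ x, G y ∂(haar p n)) γ

lemma fractionalMaximal_add_le {G H : Qpn p n → ℝ≥0∞} (hG : Measurable G) (x : Qpn p n) :
    fractionalMaximal α (G + H) x ≤ fractionalMaximal α G x + fractionalMaximal α H x := by
  refine iSup_le fun γ => ?_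
  simp only [setLAverage_eq, Pi.add_apply]
  rw [lintegral_add_left hG, ENNReal.add_div, mul_add, ← setLAverage_eq, ← setLAverage_eq]
  exact add_le_add (le_fractionalMaximal G γ x) (le_fractionalMaximal H γ x)

lemma fractionalMaximal_rpow_le {G : Qpn p n → ℝ≥0∞} {x : Qpn p n} {t : ℝ} {K : ℝ≥0∞} (ht : 0 < t)
    (h : ∀ γ, (haar p n (pBall γ x) ^ α * ⨍⁻ y in pBall γ x, G y ∂(haar p n)) ^ t ≤ K) :
    fractionalMaximal α G x ^ t ≤ K := by
  rw [fractionalMaximal, iSup_rpow _ ht]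
  exact iSup_le h

lemma measurable_fractionalMaximal {G : Qpn p n → ℝ≥0∞} (hG : Measurable G) :
    Measurable (fractionalMaximal α G) := by
  refine Measurable.iSup fun γ => ?_
  simp only [haar_pBall]
  exact (measurable_laverage_pBall (F := fun _ y => G y) (hG.comp measurable_snd) γ).const_mul _

end FractionalMaximal

section BallEstimates

variable {γ : ℤ} {x : Qpn p n} {f H : Qpn p n → ℝ≥0∞} {s : ℝ}

lemma haar_mul_setLAverage_rpow_le (hH : Measurable H) (hs : 1 ≤ s) :
    haar p n (pBall γ x) * (⨍⁻ y in pBall γ x, H y ∂(haar p n)) ^ s ≤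
      ∫⁻ y, H y ^ s ∂(haar p n) := by
  calc haar p n (pBall γ x) * (⨍⁻ y in pBall γ x, H y ∂(haar p n)) ^ s
      ≤ haar p n (pBall γ x) * ⨍⁻ y in pBall γ x, H y ^ s ∂(haar p n) :=
        mul_le_mul_right (laverage_rpow_le_laverage_rpow hH.aemeasurable hs) _
    _ = ∫⁻ y in pBall γ x, H y ^ s ∂(haar p n) :=
        measure_mul_setLAverage _ (haar_pBall_ne_top γ x)
    _ ≤ _ := setLIntegral_le_lintegral _ _

lemma haar_rpow_mul_setLAverage_le {m e : ℝ} (hf : Measurable f) (hH : Measurable H) (hs : 1 ≤ s)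
    (hsm : s ≤ m) (he : 0 ≤ e) (hem : e ≤ 1 / m)
    (h : ∀ᵐ y ∂((haar p n).restrict (pBall γ x)), f y ^ (m / s) ≤ H y) :
    haar p n (pBall γ x) ^ e * ⨍⁻ y in pBall γ x, f y ∂(haar p n) ≤
      (∫⁻ y, H y ^ s ∂(haar p n)) ^ e *
        ((⨍⁻ y in pBall γ x, H y ∂(haar p n)) ^ s) ^ (1 / m - e) := by
  have hs0 : 0 < s := by linarith
  have hm0 : 0 < m := by linarith
  set V := haar p n (pBall γ x)
  set D := (⨍⁻ y in pBall γ x, H y ∂(haar p n)) ^ s with hD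
  have hf_le : ⨍⁻ y in pBall γ x, f y ∂(haar p n) ≤ D ^ (1 / m) := by
    have hpow : (⨍⁻ y in pBall γ x, f y ∂(haar p n)) ^ (m / s) ≤
        ⨍⁻ y in pBall γ x, H y ∂(haar p n) :=
      (laverage_rpow_le_laverage_rpow hf.aemeasurable ((one_le_div hs0).2 hsm)).trans
        (laverage_mono_ae h)
    rw [hD, ← ENNReal.rpow_mul, mul_one_div, ← inv_div, ENNReal.le_rpow_inv_iff (by positivity)]
    exact hpow
  calc V ^ e * ⨍⁻ y in pBall γ x, f y ∂(haar p n) ≤ V ^ e * D ^ (e + (1 / m - e)) := by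
        rw [add_sub_cancel]
        exact mul_le_mul_right hf_le _
    _ = (V * D) ^ e * D ^ (1 / m - e) := by
        rw [ENNReal.rpow_add_of_nonneg _ _ he (sub_nonneg.2 hem),
          ENNReal.mul_rpow_of_nonneg _ _ he, mul_assoc]
    _ ≤ _ := mul_le_mul_left
        (ENNReal.rpow_le_rpow (haar_mul_setLAverage_rpow_le hH hs) he) _

lemma haar_pBall_rpow_le {m t C : ℝ} (hm : 1 ≤ m) (ht : 1 ≤ t) (hC : 0 ≤ C)
    (h : -(γ : ℝ) * (t - m) ≤ C) :
    haar p n (pBall γ x) ^ (1 / t - 1 / m) ≤ (p : ℝ≥0∞) ^ (n * C) := by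
  rw [haar_pBall, ← ENNReal.rpow_mul]
  refine ENNReal.rpow_le_rpow_of_exponent_le (one_le_prime p) ?_
  have hmt : 1 ≤ t * m := one_le_mul_of_one_le_of_one_le ht hm
  calc n * γ * (1 / t - 1 / m) = n * (-(γ : ℝ) * (t - m) / (t * m)) := by
        field_simp
        ring
    _ ≤ n * C := by
        gcongr
        rw [div_le_iff₀ (by positivity)]
        exact h.trans (le_mul_of_one_le_right hC hmt)

end BallEstimates

section LargePart

variable {α s C : ℝ} {r : Qpn p n → ℝ} {f : Qpn p n → ℝ≥0∞}

lemma lintegral_rpow_div_rpow (hs : s ≠ 0) :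
    ∫⁻ y, (f y ^ (r y / s)) ^ s ∂(haar p n) = ∫⁻ y, f y ^ r y ∂(haar p n) :=
  lintegral_congr fun y => by rw [← ENNReal.rpow_mul, div_mul_cancel₀ _ hs]

lemma haar_rpow_mul_setLAverage_rpow_le_of_large {γ : ℤ} {x : Qpn p n} {m t : ℝ} (hα : 0 ≤ α)
    (htα : α < 1 / t) (hs : 1 ≤ s) (hsm : s ≤ m) (hmt : m ≤ t) (hC : 0 ≤ C)
    (hγ : -(γ : ℝ) * (t - m) ≤ C) (hr : Measurable r)
    (hmr : ∀ᵐ y ∂((haar p n).restrict (pBall γ x)), m ≤ r y) (hf : Measurable f)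
    (hf1 : ∀ y, f y = 0 ∨ 1 ≤ f y) (hint : ∫⁻ y, f y ^ r y ∂(haar p n) ≤ 1) :
    (haar p n (pBall γ x) ^ α * ⨍⁻ y in pBall γ x, f y ∂(haar p n)) ^ sobolevExponent α t ≤
      (p : ℝ≥0∞) ^ (n * C * sobolevExponent α t) *
        (⨍⁻ y in pBall γ x, f y ^ (r y / s) ∂(haar p n)) ^ s := by
  have hs0 : 0 < s := by linarith
  have hm0 : 0 < m := by linarith
  set q := sobolevExponent α t
  have hq : 0 < q := sobolevExponent_pos htα
  have hqinv : 1 / q = 1 / t - α := one_div_sobolevExponent α t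
  have he : 0 ≤ 1 / m - 1 / q := by
    have := one_div_le_one_div_of_le hm0 hmt
    linarith
  set V := haar p n (pBall γ x)
  set D := (⨍⁻ y in pBall γ x, f y ^ (r y / s) ∂(haar p n)) ^ s
  have hle : V ^ (1 / m - 1 / q) * ⨍⁻ y in pBall γ x, f y ∂(haar p n) ≤ D ^ (1 / q) := by
    refine (haar_rpow_mul_setLAverage_le hf (hf.pow (hr.div_const s)) hs hsm he
      (sub_le_self _ (by positivity)) ?_).trans ?_
    · filter_upwards [hmr] with y hy
      rcases hf1 y with h0 | h1
      · rw [h0, ENNReal.zero_rpow_of_pos (by positivity)]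
        exact zero_le
      · exact ENNReal.rpow_le_rpow_of_exponent_le h1 (by gcongr)
    · rw [lintegral_rpow_div_rpow hs0.ne', sub_sub_cancel]
      exact mul_le_of_le_one_left' (ENNReal.rpow_le_one hint he)
  calc (V ^ α * ⨍⁻ y in pBall γ x, f y ∂(haar p n)) ^ q
      = (V ^ (1 / t - 1 / m) *
          (V ^ (1 / m - 1 / q) * ⨍⁻ y in pBall γ x, f y ∂(haar p n))) ^ q := by
        rw [← mul_assoc, ← ENNReal.rpow_add _ _ (haar_pBall_ne_zero γ x) (haar_pBall_ne_top γ x),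
          hqinv, sub_add_sub_cancel, sub_sub_cancel]
    _ ≤ ((p : ℝ≥0∞) ^ (n * C) * D ^ (1 / q)) ^ q := by
        gcongr
        exact haar_pBall_rpow_le (hs.trans hsm) ((hs.trans hsm).trans hmt) hC hγ
    _ = (p : ℝ≥0∞) ^ (n * C * q) * D := by
        rw [ENNReal.mul_rpow_of_nonneg _ _ hq.le, ← ENNReal.rpow_mul, ← ENNReal.rpow_mul,
          one_div_mul_cancel hq.ne', ENNReal.rpow_one]

variable (hr : IsLogHolder r) (hα : 0 ≤ α) (hR : α < 1 / essSup r (haar p n))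
include hr hR

lemma IsLogHolder.lt_one_div {t : ℝ} (ht : t ∈ Icc (essInf r (haar p n)) (essSup r (haar p n))) :
    α < 1 / t :=
  hR.trans_le (one_div_le_one_div_of_le
    (zero_lt_one.trans (hr.isExponent.one_lt_essInf.trans_le ht.1)) ht.2)

lemma IsLogHolder.sobolevExponent_le {t : ℝ}
    (ht : t ∈ Icc (essInf r (haar p n)) (essSup r (haar p n))) :
    sobolevExponent α t ≤ sobolevExponent α (essSup r (haar p n)) :=
  sobolevExponent_le_sobolevExponent
    (zero_lt_one.trans (hr.isExponent.one_lt_essInf.trans_le ht.1)) ht.2 hR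

include hα

lemma IsLogHolder.one_lt_sobolevExponent {t : ℝ}
    (ht : t ∈ Icc (essInf r (haar p n)) (essSup r (haar p n))) : 1 < sobolevExponent α t :=
  have h1 : 1 < t := hr.isExponent.one_lt_essInf.trans_le ht.1
  h1.trans_le (le_sobolevExponent hα (by linarith) (hr.lt_one_div hR ht))

lemma IsLogHolder.exists_ae_fractionalMaximal_rpow_le_of_large :
    ∃ K : ℝ≥0∞, K ≠ ∞ ∧ ∀ f : Qpn p n → ℝ≥0∞, Measurable f → (∀ y, f y = 0 ∨ 1 ≤ f y) →
      ∫⁻ y, f y ^ r y ∂(haar p n) ≤ 1 → ∀ᵐ x ∂(haar p n),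
        fractionalMaximal α f x ^ sobolevExponent α (r x) ≤
          K * maximalFunction (fun y => f y ^ (r y / essInf r (haar p n))) x ^
            essInf r (haar p n) := by
  have hs := hr.isExponent.one_lt_essInf
  obtain ⟨C, hC, hloc⟩ := hr.exists_local
  refine ⟨(p : ℝ≥0∞) ^ (n * C * sobolevExponent α (essSup r (haar p n))),
    prime_rpow_ne_top p _, fun f hf hf1 hint => ?_⟩
  filter_upwards [ae_forall_pBall (P := fun B γ y => essInf r ((haar p n).restrict B) ≤ r y ∧
    -(γ : ℝ) * (r y - essInf r ((haar p n).restrict B)) ≤ C) hloc] with x hx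
  have hrx := hr.isExponent.mem_Icc x
  have hqx := hr.one_lt_sobolevExponent hα hR hrx
  refine fractionalMaximal_rpow_le (by linarith) fun γ => ?_
  have hm := hr.isExponent.essInf_mem_Icc ((haar p n).restrict (pBall γ x))
  refine (haar_rpow_mul_setLAverage_rpow_le_of_large hα (hr.lt_one_div hR hrx) hs.le hm.1 (hx γ).1
    hC (hx γ).2 hr.isExponent.measurable ((hloc γ x).mono fun y hy => hy.1) hf hf1 hint).trans ?_
  refine mul_le_mul' (ENNReal.rpow_le_rpow_of_exponent_le (one_le_prime p) ?_) ?_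
  · exact mul_le_mul_of_nonneg_left (hr.sobolevExponent_le hR hrx) (by positivity)
  · exact ENNReal.rpow_le_rpow (laverage_pBall_le_maximalFunction _ γ x) (by linarith)

lemma IsLogHolder.exists_lintegral_fractionalMaximal_rpow_le_of_large (hn : n ≠ 0) :
    ∃ K : ℝ≥0∞, K ≠ ∞ ∧ ∀ f : Qpn p n → ℝ≥0∞, Measurable f → (∀ y, f y = 0 ∨ 1 ≤ f y) →
      ∫⁻ y, f y ^ r y ∂(haar p n) ≤ 1 →
      ∫⁻ x, fractionalMaximal α f x ^ sobolevExponent α (r x) ∂(haar p n) ≤ K := by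
  have hs := hr.isExponent.one_lt_essInf
  obtain ⟨K, hK, hle⟩ := hr.exists_ae_fractionalMaximal_rpow_le_of_large hα hR
  obtain ⟨M, hM⟩ := exists_lintegral_maximalFunction_rpow_le (p := p) hn hs
  set s := essInf r (haar p n)
  refine ⟨K * M, ENNReal.mul_ne_top hK ENNReal.coe_ne_top, fun f hf hf1 hint => ?_⟩
  calc ∫⁻ x, fractionalMaximal α f x ^ sobolevExponent α (r x) ∂(haar p n)
      ≤ ∫⁻ x, K * maximalFunction (fun y => f y ^ (r y / s)) x ^ s ∂(haar p n) :=
        lintegral_mono_ae (hle f hf hf1 hint)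
    _ = K * ∫⁻ x, maximalFunction (fun y => f y ^ (r y / s)) x ^ s ∂(haar p n) :=
        lintegral_const_mul' _ _ hK
    _ ≤ K * (M * ∫⁻ y, (f y ^ (r y / s)) ^ s ∂(haar p n)) :=
        mul_le_mul_right (hM _ (hf.pow (hr.isExponent.measurable.div_const s))) _
    _ ≤ K * M := by
        rw [lintegral_rpow_div_rpow (by linarith)]
        exact mul_le_mul_right (mul_le_of_le_one_right' hint) _

end LargePart

section SmallPart

variable {α s : ℝ} {r : Qpn p n → ℝ} {f : Qpn p n → ℝ≥0∞}

lemma lintegral_const_mul_add_decayWeight_rpow_le (hr : Measurable r) (hs : 1 ≤ s) (c : ℝ≥0∞)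
    (hf : Measurable f) (hint : ∫⁻ y, f y ^ r y ∂(haar p n) ≤ 1) :
    ∫⁻ y, (c * f y ^ (r y / s) + decayWeight y) ^ s ∂(haar p n) ≤
      2 ^ (s - 1) * (c ^ s + ∫⁻ y, decayWeight (p := p) (n := n) y ∂(haar p n)) := by
  have hs0 : 0 < s := by linarith
  calc ∫⁻ y, (c * f y ^ (r y / s) + decayWeight y) ^ s ∂(haar p n)
      ≤ ∫⁻ y, 2 ^ (s - 1) * (c ^ s * f y ^ r y + decayWeight y) ∂(haar p n) := by
        refine lintegral_mono fun y => (ENNReal.rpow_add_le_mul_rpow_add_rpow _ _ hs).trans ?_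
        rw [ENNReal.mul_rpow_of_nonneg _ _ hs0.le, ← ENNReal.rpow_mul, div_mul_cancel₀ _ hs0.ne']
        gcongr
        exact ENNReal.rpow_le_self_of_le_one (decayWeight_le_one y) hs
    _ = 2 ^ (s - 1) * (c ^ s * ∫⁻ y, f y ^ r y ∂(haar p n) + ∫⁻ y, decayWeight y ∂(haar p n)) := by
        rw [lintegral_const_mul' _ _ (ENNReal.rpow_ne_top_of_nonneg (by linarith) (by simp)),
          lintegral_add_right _ measurable_decayWeight, lintegral_const_mul _ (hf.pow hr)]
    _ ≤ _ := by
        gcongr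
        exact mul_le_of_le_one_right' hint

lemma rpow_sobolevExponent_div_le {R t t₀ C : ℝ} {D K : ℝ≥0∞} {x : Qpn p n} (hα : 0 ≤ α)
    (ht : t ∈ Icc 1 R) (ht₀ : t₀ ∈ Icc 1 R) (hR : α < 1 / R) (hC : 0 ≤ C)
    (hlog : |t - t₀| ≤ C / Real.logb p (p + ‖x‖)) (hDK : D ≤ K) (hK : 1 ≤ K) (hK' : K ≠ ∞) :
    D ^ (sobolevExponent α t / sobolevExponent α t₀) ≤
      K ^ sobolevExponent α R *
        (p : ℝ≥0∞) ^ ((n + 1) * (sobolevExponent α R ^ 2 * C) / (1 / sobolevExponent α R)) *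
          (D + decayWeight x) := by
  have one_le {u : ℝ} (hu : u ∈ Icc 1 R) : 1 ≤ sobolevExponent α u :=
    have hu0 : 0 < u := by linarith [hu.1]
    hu.1.trans (le_sobolevExponent hα hu0 (hR.trans_le (one_div_le_one_div_of_le hu0 hu.2)))
  have hq := one_le ht
  have hq₀ := one_le ht₀
  have hqR : sobolevExponent α t ≤ sobolevExponent α R :=
    sobolevExponent_le_sobolevExponent (by linarith [ht.1]) ht.2 hR
  have hq₀R : sobolevExponent α t₀ ≤ sobolevExponent α R :=
    sobolevExponent_le_sobolevExponent (by linarith [ht₀.1]) ht₀.2 hR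
  have hdiff := abs_sobolevExponent_sub_le ht.1 ht₀.1 ht.2 ht₀.2 hR
  set q := sobolevExponent α t
  set q₀ := sobolevExponent α t₀
  set Q := sobolevExponent α R
  have hq₀0 : 0 < q₀ := by linarith
  have hQ0 : 0 < Q := by linarith
  refine (rpow_le_mul_add_decayWeight_of_le hDK hK hK' (one_div_pos.2 hQ0) ?_
    (by positivity : 0 ≤ Q ^ 2 * C) x ?_).trans ?_
  · gcongr
  · rw [div_sub_one hq₀0.ne', abs_div, abs_of_pos hq₀0, mul_div_assoc]
    exact (div_le_self (abs_nonneg _) hq₀).trans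
      (hdiff.trans (mul_le_mul_of_nonneg_left hlog (by positivity)))
  · gcongr
    exact (div_le_self (by linarith) hq₀).trans hqR

lemma haar_rpow_mul_setLAverage_rpow_le_of_small {γ : ℤ} {x : Qpn p n} {H : Qpn p n → ℝ≥0∞}
    {J K : ℝ≥0∞} {R t t₀ C : ℝ} (hs : 1 ≤ s) (hα : 0 ≤ α) (ht : t ∈ Icc s R) (ht₀ : t₀ ∈ Icc s R)
    (hR : α < 1 / R) (hC : 0 ≤ C) (hlog : |t - t₀| ≤ C / Real.logb p (p + ‖x‖))
    (hf : Measurable f) (hH : Measurable H) (hfH : ∀ y, f y ^ (t₀ / s) ≤ H y)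
    (hHK : ∀ y, H y ≤ K) (hK : 1 ≤ K) (hK' : K ≠ ∞)
    (hJ : ∫⁻ y, H y ^ s ∂(haar p n) ≤ J) (hJ1 : 1 ≤ J) :
    (haar p n (pBall γ x) ^ α * ⨍⁻ y in pBall γ x, f y ∂(haar p n)) ^ sobolevExponent α t ≤
      J ^ (α * sobolevExponent α R) * ((K ^ s) ^ sobolevExponent α R *
        (p : ℝ≥0∞) ^ ((n + 1) * (sobolevExponent α R ^ 2 * C) / (1 / sobolevExponent α R))) *
          ((⨍⁻ y in pBall γ x, H y ∂(haar p n)) ^ s + decayWeight x) := by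
  have hs0 : 0 < s := by linarith
  have ht₀α : α < 1 / t₀ := hR.trans_le (one_div_le_one_div_of_le (by linarith [ht₀.1]) ht₀.2)
  have htα : α < 1 / t := hR.trans_le (one_div_le_one_div_of_le (by linarith [ht.1]) ht.2)
  have hq : 0 < sobolevExponent α t := sobolevExponent_pos htα
  have hqR : sobolevExponent α t ≤ sobolevExponent α R :=
    sobolevExponent_le_sobolevExponent (by linarith [ht.1]) ht.2 hR
  set D := (⨍⁻ y in pBall γ x, H y ∂(haar p n)) ^ s
  have hDK : D ≤ K ^ s := by
    refine ENNReal.rpow_le_rpow ((laverage_mono_ae (ae_of_all _ hHK)).trans_eq ?_) hs0.le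
    exact laverage_const _ _
  have hK1 : 1 ≤ K ^ s := ENNReal.one_le_rpow hK hs0
  calc (haar p n (pBall γ x) ^ α * ⨍⁻ y in pBall γ x, f y ∂(haar p n)) ^ sobolevExponent α t
      ≤ (J ^ α * D ^ (1 / sobolevExponent α t₀)) ^ sobolevExponent α t := by
        rw [one_div_sobolevExponent]
        exact ENNReal.rpow_le_rpow ((haar_rpow_mul_setLAverage_le hf hH hs ht₀.1 hα ht₀α.le
          (ae_of_all _ hfH)).trans (mul_le_mul_left (ENNReal.rpow_le_rpow hJ hα) _)) hq.le
    _ = J ^ (α * sobolevExponent α t) * D ^ (sobolevExponent α t / sobolevExponent α t₀) := by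
        rw [ENNReal.mul_rpow_of_nonneg _ _ hq.le, ← ENNReal.rpow_mul, ← ENNReal.rpow_mul,
          one_div_mul_eq_div]
    _ ≤ _ := by
        rw [mul_assoc]
        refine mul_le_mul' (ENNReal.rpow_le_rpow_of_exponent_le hJ1 (by gcongr)) ?_
        exact rpow_sobolevExponent_div_le hα ⟨hs.trans ht.1, ht.2⟩ ⟨hs.trans ht₀.1, ht₀.2⟩ hR hC
          hlog hDK hK1 (ENNReal.rpow_ne_top_of_nonneg hs0.le hK')

variable (hr : IsLogHolder r) (hα : 0 ≤ α) (hR : α < 1 / essSup r (haar p n)) (hn : n ≠ 0)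
include hr hα hR hn

lemma IsLogHolder.exists_fractionalMaximal_rpow_le_of_small :
    ∃ c K : ℝ≥0∞, c ≠ ∞ ∧ K ≠ ∞ ∧ ∀ f : Qpn p n → ℝ≥0∞, Measurable f → (∀ y, f y ≤ 1) →
      ∫⁻ y, f y ^ r y ∂(haar p n) ≤ 1 → ∀ x,
        fractionalMaximal α f x ^ sobolevExponent α (r x) ≤
          K * (maximalFunction
            (fun y => c * f y ^ (r y / essInf r (haar p n)) + decayWeight y) x ^
              essInf r (haar p n) + decayWeight x) := by
  have hs := hr.isExponent.one_lt_essInf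
  have hmem := hr.isExponent.mem_Icc
  have hrm := hr.isExponent.measurable
  have hq := fun x => hr.one_lt_sobolevExponent hα hR (hmem x)
  have hQ := (hq 0).trans_le (hr.sobolevExponent_le hR (hmem 0))
  obtain ⟨C, hC, r₀, hr₀, hlog⟩ := hr.exists_atInfinity hn
  set s := essInf r (haar p n)
  have hs0 : 0 < s := by linarith
  set Q := sobolevExponent α (essSup r (haar p n))
  set c : ℝ≥0∞ := (p : ℝ≥0∞) ^ ((n + 1) * C / 1)
  have hct : c ≠ ∞ := prime_rpow_ne_top p _
  set J : ℝ≥0∞ := 2 ^ (s - 1) * (c ^ s + ∫⁻ y, decayWeight (p := p) (n := n) y ∂(haar p n)) + 1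
  have hJ : J ≠ ∞ := ENNReal.add_ne_top.2 ⟨ENNReal.mul_ne_top
    (ENNReal.rpow_ne_top_of_nonneg (by linarith) (by simp)) (ENNReal.add_ne_top.2
      ⟨ENNReal.rpow_ne_top_of_nonneg hs0.le hct, lintegral_decayWeight_lt_top.ne⟩), by simp⟩
  refine ⟨c, J ^ (α * Q) * (((c + 1) ^ s) ^ Q *
      (p : ℝ≥0∞) ^ ((n + 1) * (Q ^ 2 * C) / (1 / Q))), hct,
    ENNReal.mul_ne_top (ENNReal.rpow_ne_top_of_nonneg (by positivity) hJ) (ENNReal.mul_ne_top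
      (ENNReal.rpow_ne_top_of_nonneg (by positivity) (ENNReal.rpow_ne_top_of_nonneg hs0.le
        (by finiteness))) (prime_rpow_ne_top p _)),
    fun f hf hf1 hint x => fractionalMaximal_rpow_le (by linarith [hq x]) fun γ => ?_⟩
  refine (haar_rpow_mul_setLAverage_rpow_le_of_small
    (H := fun y => c * f y ^ (r y / s) + decayWeight y) hs.le hα (hmem x) hr₀ hR hC (hlog x) hf
    (((hf.pow (hrm.div_const s)).const_mul _).add measurable_decayWeight) (fun y => ?_)
    (K := c + 1) (fun y => ?_) le_add_self (by finiteness)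
    ((lintegral_const_mul_add_decayWeight_rpow_le hrm hs.le c hf hint).trans le_self_add)
    le_add_self).trans ?_
  · refine rpow_le_mul_rpow_add_decayWeight (hf1 y) one_pos ((one_le_div hs0).2 hr₀.1) hC y ?_
    rw [← sub_div, abs_div, abs_of_pos hs0, abs_sub_comm]
    exact (div_le_self (abs_nonneg _) hs.le).trans (hlog y)
  · refine add_le_add (mul_le_of_le_one_right' ?_) (decayWeight_le_one y)
    exact ENNReal.rpow_le_one (hf1 y) (div_nonneg (hs0.le.trans (hmem y).1) hs0.le)
  · gcongr
    exact laverage_pBall_le_maximalFunction _ γ x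

lemma IsLogHolder.exists_lintegral_fractionalMaximal_rpow_le_of_small :
    ∃ K : ℝ≥0∞, K ≠ ∞ ∧ ∀ f : Qpn p n → ℝ≥0∞, Measurable f → (∀ y, f y ≤ 1) →
      ∫⁻ y, f y ^ r y ∂(haar p n) ≤ 1 →
      ∫⁻ x, fractionalMaximal α f x ^ sobolevExponent α (r x) ∂(haar p n) ≤ K := by
  have hs := hr.isExponent.one_lt_essInf
  have hrm := hr.isExponent.measurable
  obtain ⟨c, K, hc, hK, hle⟩ := hr.exists_fractionalMaximal_rpow_le_of_small hα hR hn
  obtain ⟨M, hM⟩ := exists_lintegral_maximalFunction_rpow_le (p := p) hn hs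
  set s := essInf r (haar p n)
  set I := ∫⁻ y, decayWeight (p := p) (n := n) y ∂(haar p n)
  have hI : I ≠ ∞ := lintegral_decayWeight_lt_top.ne
  have hJ : (2 : ℝ≥0∞) ^ (s - 1) * (c ^ s + I) ≠ ∞ :=
    ENNReal.mul_ne_top (ENNReal.rpow_ne_top_of_nonneg (by linarith) (by simp))
      (ENNReal.add_ne_top.2 ⟨ENNReal.rpow_ne_top_of_nonneg (by linarith) hc, hI⟩)
  refine ⟨K * (M * (2 ^ (s - 1) * (c ^ s + I)) + I), by finiteness, fun f hf hf1 hint => ?_⟩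
  set H : Qpn p n → ℝ≥0∞ := fun y => c * f y ^ (r y / s) + decayWeight y
  have hHm : Measurable H :=
    ((hf.pow (hrm.div_const s)).const_mul _).add measurable_decayWeight
  calc ∫⁻ x, fractionalMaximal α f x ^ sobolevExponent α (r x) ∂(haar p n)
      ≤ ∫⁻ x, K * (maximalFunction H x ^ s + decayWeight x) ∂(haar p n) :=
        lintegral_mono (hle f hf hf1 hint)
    _ = K * (∫⁻ x, maximalFunction H x ^ s ∂(haar p n) + I) := by
        rw [lintegral_const_mul' _ _ hK, lintegral_add_right _ measurable_decayWeight]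
    _ ≤ _ := by
        gcongr
        exact (hM H hHm).trans (mul_le_mul_right
          (lintegral_const_mul_add_decayWeight_rpow_le hrm hs.le c hf hint) _)

theorem IsLogHolder.exists_lintegral_fractionalMaximal_rpow_le :
    ∃ K : ℝ≥0∞, K ≠ ∞ ∧ ∀ f : Qpn p n → ℝ≥0∞, Measurable f →
      ∫⁻ y, f y ^ r y ∂(haar p n) ≤ 1 →
      ∫⁻ x, fractionalMaximal α f x ^ sobolevExponent α (r x) ∂(haar p n) ≤ K := by
  have hq := fun x => hr.one_lt_sobolevExponent hα hR (hr.isExponent.mem_Icc x)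
  have hqQ := fun x => hr.sobolevExponent_le hR (hr.isExponent.mem_Icc x)
  set Q := sobolevExponent α (essSup r (haar p n))
  obtain ⟨K₁, hK₁, hlarge⟩ := hr.exists_lintegral_fractionalMaximal_rpow_le_of_large hα hR hn
  obtain ⟨K₂, hK₂, hsmall⟩ := hr.exists_lintegral_fractionalMaximal_rpow_le_of_small hα hR hn
  refine ⟨2 ^ Q * (K₁ + K₂), by finiteness, fun f hf hint => ?_⟩
  set S := {y | 1 ≤ f y}
  have hS : MeasurableSet S := measurableSet_le measurable_const hf
  have hint_indicator (A : Set (Qpn p n)) : ∫⁻ y, A.indicator f y ^ r y ∂(haar p n) ≤ 1 :=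
    (lintegral_mono fun y => ENNReal.rpow_le_rpow (indicator_le_self A f y)
      (by linarith [hr.isExponent.one_lt y])).trans hint
  have h₁ := hlarge _ (hf.indicator hS) (fun y => (em (y ∈ S)).symm.imp
    (fun hy => indicator_of_notMem hy f) fun hy => by rwa [indicator_of_mem hy]) (hint_indicator S)
  have h₂ := hsmall _ (hf.indicator hS.compl) (indicator_le fun y (hy : ¬1 ≤ f y) =>
    (not_le.1 hy).le) (hint_indicator Sᶜ)
  calc ∫⁻ x, fractionalMaximal α f x ^ sobolevExponent α (r x) ∂(haar p n)
      ≤ ∫⁻ x, 2 ^ Q * (fractionalMaximal α (S.indicator f) x ^ sobolevExponent α (r x) +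
          fractionalMaximal α (Sᶜ.indicator f) x ^ sobolevExponent α (r x)) ∂(haar p n) := by
        refine lintegral_mono fun x => ?_
        have hadd := fractionalMaximal_add_le (α := α) (H := Sᶜ.indicator f) (hf.indicator hS) x
        rw [indicator_self_add_compl] at hadd
        refine (ENNReal.rpow_le_rpow hadd (by linarith [hq x])).trans
          ((ENNReal.rpow_add_le_mul_rpow_add_rpow _ _ (hq x).le).trans ?_)
        gcongr
        · norm_num
        · linarith [hqQ x]
    _ = 2 ^ Q *
        (∫⁻ x, fractionalMaximal α (S.indicator f) x ^ sobolevExponent α (r x) ∂(haar p n) +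
          ∫⁻ x, fractionalMaximal α (Sᶜ.indicator f) x ^ sobolevExponent α (r x) ∂(haar p n)) := by
        rw [lintegral_const_mul' _ _ (by finiteness), lintegral_add_left]
        exact (measurable_fractionalMaximal (hf.indicator hS)).pow
          (measurable_sobolevExponent.comp hr.isExponent.measurable)
    _ ≤ 2 ^ Q * (K₁ + K₂) := mul_le_mul_right (add_le_add h₁ h₂) _

end SmallPart

section LuxemburgNorm

variable {ε ε' : Type*} [TopologicalSpace ε] [ContinuousENorm ε] [TopologicalSpace ε']
  [ContinuousENorm ε'] {q r : Qpn p n → ℝ} {f : Qpn p n → ε} {g : Qpn p n → ε'}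

lemma luxNorm_le {η : ℝ≥0} (hη : 0 < η) (h : modular q f η ≤ 1) : luxNorm q f ≤ η :=
  iInf₂_le η ⟨hη, h⟩

lemma modular_mul_le (hq : ∀ x, 1 ≤ q x) {k : ℝ≥0} (hk : 1 ≤ k) (η : ℝ≥0) :
    modular q f (k * η) ≤ (k : ℝ≥0∞)⁻¹ * modular q f η := by
  have hk0 : (k : ℝ≥0∞) ≠ 0 := by exact_mod_cast (one_pos.trans_le hk).ne'
  have hk' : (k : ℝ≥0∞)⁻¹ ≤ 1 := ENNReal.inv_le_one.2 (by exact_mod_cast hk)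
  rw [modular, modular, ← lintegral_const_mul' _ _ (ENNReal.inv_ne_top.2 hk0)]
  refine lintegral_mono fun x => ?_
  calc (‖f x‖ₑ / (k * η : ℝ≥0)) ^ q x = ((k : ℝ≥0∞)⁻¹ * (‖f x‖ₑ / η)) ^ q x := by
        rw [ENNReal.coe_mul, div_eq_mul_inv, div_eq_mul_inv,
          ENNReal.mul_inv (Or.inl hk0) (Or.inl ENNReal.coe_ne_top), mul_left_comm]
    _ ≤ (k : ℝ≥0∞)⁻¹ * (‖f x‖ₑ / η) ^ q x := by
        rw [ENNReal.mul_rpow_of_nonneg _ _ (zero_le_one.trans (hq x))]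
        exact mul_le_mul_left (ENNReal.rpow_le_self_of_le_one hk' (hq x)) _

lemma modular_max_one_mul_le_one (hq : ∀ x, 1 ≤ q x) {k η : ℝ≥0} (h : modular q f η ≤ k) :
    modular q f (max 1 k * η) ≤ 1 := by
  refine (modular_mul_le hq (le_max_left 1 k) η).trans ?_
  rw [← ENNReal.div_eq_inv_mul]
  refine ENNReal.div_le_of_le_mul ?_
  rw [one_mul]
  exact h.trans (by exact_mod_cast le_max_right 1 k)

lemma MemLvar.exists_modular_le_one (hq : ∀ x, 1 ≤ q x) (hf : MemLvar q f) :
    ∃ η : ℝ≥0, 0 < η ∧ modular q f η ≤ 1 := by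
  obtain ⟨-, η, hη, h⟩ := hf
  exact ⟨max 1 (modular q f η).toNNReal * η, mul_pos (one_pos.trans_le (le_max_left _ _)) hη,
    modular_max_one_mul_le_one hq (ENNReal.coe_toNNReal h.ne).ge⟩

lemma luxNorm_le_mul {C : ℝ≥0} (hC : 0 < C)
    (h : ∀ η : ℝ≥0, 0 < η → modular r g η ≤ 1 → modular q f (C * η) ≤ 1) :
    luxNorm q f ≤ C * luxNorm r g := by
  have hC0 : (C : ℝ≥0∞) ≠ 0 := by exact_mod_cast hC.ne'
  rw [luxNorm.eq_1 (f := g)]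
  simp only [ENNReal.mul_iInf_of_ne hC0 ENNReal.coe_ne_top]
  exact le_iInf₂ fun η hη => (luxNorm_le (mul_pos hC hη.1) (h η hη.1 hη.2)).trans_eq
    (ENNReal.coe_mul C η)

lemma luxNorm_le_mul_of_enorm_le (hq : ∀ x, 0 ≤ q x) {C : ℝ≥0∞} (hC0 : C ≠ 0) (hC : C ≠ ∞)
    (h : ∀ᵐ x ∂(haar p n), ‖f x‖ₑ ≤ C * ‖g x‖ₑ) : luxNorm q f ≤ C * luxNorm q g := by
  lift C to ℝ≥0 using hC
  have hCpos : 0 < C := pos_iff_ne_zero.2 (by exact_mod_cast hC0)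
  refine luxNorm_le_mul hCpos fun η _ hm => (lintegral_mono_ae ?_).trans hm
  filter_upwards [h] with x hx
  refine ENNReal.rpow_le_rpow ?_ (hq x)
  calc ‖f x‖ₑ / (C * η : ℝ≥0) ≤ C * ‖g x‖ₑ / (C * η) := by
        rw [ENNReal.coe_mul]
        gcongr
    _ = _ := ENNReal.mul_div_mul_left _ _ hC0 ENNReal.coe_ne_top

end LuxemburgNorm

section AdmissiblePair

variable {β : ℝ} {r q : Qpn p n → ℝ}

lemma AdmissiblePair.one_lt_div (h : AdmissiblePair β r q) : 1 < n / β :=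
  (h.logHolder_r.isExponent.one_lt 0).trans_le
    ((h.logHolder_r.isExponent.le_essSup 0).trans h.essSup_lt.le)

lemma AdmissiblePair.beta_pos (h : AdmissiblePair β r q) : 0 < β := by
  by_contra! hβ
  exact (zero_lt_one.trans h.one_lt_div).not_ge (div_nonpos_of_nonneg_of_nonpos n.cast_nonneg hβ)

lemma AdmissiblePair.dim_ne_zero (h : AdmissiblePair β r q) : n ≠ 0 := by
  rintro rfl
  simpa using zero_lt_one.trans h.one_lt_div

lemma AdmissiblePair.div_lt (h : AdmissiblePair β r q) : β / n < 1 / essSup r (haar p n) := by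
  have hR : 0 < essSup r (haar p n) :=
    zero_lt_one.trans ((h.logHolder_r.isExponent.one_lt 0).trans_le
      (h.logHolder_r.isExponent.le_essSup 0))
  rw [← inv_div, ← one_div]
  exact one_div_lt_one_div_of_lt hR h.essSup_lt

lemma AdmissiblePair.eq_sobolevExponent (h : AdmissiblePair β r q) (y : Qpn p n) :
    q y = sobolevExponent (β / n) (r y) := by
  rw [sobolevExponent, ← h.one_div_eq y, one_div, inv_inv]

end AdmissiblePair

section MaximalCommutator

variable {b f : Qpn p n → ℝ}

lemma enorm_sub_average_le {X E : Type*} [MeasurableSpace X] {μ : Measure X} [IsFiniteMeasure μ]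
    [NeZero μ] [NormedAddCommGroup E] [NormedSpace ℝ E] [CompleteSpace E] {h : X → E}
    (hh : Integrable h μ) (c : E) : ‖c - ⨍ y, h y ∂μ‖ₑ ≤ ⨍⁻ y, ‖c - h y‖ₑ ∂μ := by
  have hsub : c - ⨍ y, h y ∂μ = ⨍ y, (c - h y) ∂μ := by
    rw [average, average, integral_sub (integrable_const c) hh.to_average, integral_const,
      probReal_univ, one_smul]
  rw [hsub]
  exact enorm_integral_le_lintegral_enorm _

lemma integrableOn_pBall (hb : LocallyIntegrable b (haar p n)) (γ : ℤ) (a : Qpn p n) :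
    IntegrableOn b (pBall γ a) (haar p n) :=
  hb.integrableOn_isCompact (isCompact_closedBall _ _)

lemma maximalCommutator_eq_iSup_setLAverage (b f : Qpn p n → ℝ) (x : Qpn p n) :
    maximalCommutator b f x =
      ⨆ γ : ℤ, ⨍⁻ y in pBall γ x, ‖b x - b y‖ₑ * ‖f y‖ₑ ∂(haar p n) := by
  simp only [maximalCommutator, setLAverage_eq, ENNReal.div_eq_inv_mul]

lemma aemeasurable_maximalCommutator (hb : AEMeasurable b (haar p n))
    (hf : AEMeasurable f (haar p n)) : AEMeasurable (maximalCommutator b f) (haar p n) := by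
  have hbm := hb.measurable_mk
  have hfm := hf.measurable_mk
  refine ⟨maximalCommutator (hb.mk b) (hf.mk f), ?_, ?_⟩
  · simp only [funext (maximalCommutator_eq_iSup_setLAverage _ _)]
    refine Measurable.iSup fun γ => measurable_laverage_pBall
      (F := fun x y => ‖hb.mk b x - hb.mk b y‖ₑ * ‖hf.mk f y‖ₑ) ?_ γ
    exact ((hbm.comp measurable_fst).sub (hbm.comp measurable_snd)).enorm.mul
      (hfm.comp measurable_snd).enorm
  · filter_upwards [hb.ae_eq_mk] with x hx
    simp only [maximalCommutator_eq_iSup_setLAverage]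
    refine iSup_congr fun γ => laverage_congr ?_
    filter_upwards [ae_restrict_of_ae hb.ae_eq_mk, ae_restrict_of_ae hf.ae_eq_mk] with y hby hfy
    rw [hx, hby, hfy]

end MaximalCommutator

section Lipschitz

variable {β : ℝ} {b g : Qpn p n → ℝ} {Λ : ℝ≥0∞}

lemma enorm_sub_le_lipNorm_mul (hβ : 0 ≤ β) (g : Qpn p n → ℝ) (x y : Qpn p n) :
    ‖g x - g y‖ₑ ≤ lipNorm β g * ‖x - y‖ₑ ^ β := by
  rcases eq_or_ne x y with rfl | hxy
  · simp
  have hne : ‖x - y‖ₑ ^ β ≠ 0 :=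
    (ENNReal.rpow_pos (by simpa [pos_iff_ne_zero, sub_eq_zero] using hxy) enorm_ne_top).ne'
  rw [← ENNReal.div_le_iff hne (ENNReal.rpow_ne_top_of_nonneg hβ enorm_ne_top)]
  exact le_iSup_of_le x (le_iSup_of_le y (le_iSup_of_le hxy le_rfl))

lemma enorm_sub_le_of_mem_pBall (hβ : 0 ≤ β) (hg : lipNorm β g ≤ Λ) {x y : Qpn p n} {γ : ℤ}
    (h : y ∈ pBall γ x) : ‖g x - g y‖ₑ ≤ Λ * (p : ℝ≥0∞) ^ (γ * β) := by
  have hnorm : ‖x - y‖ₑ ≤ (p : ℝ≥0∞) ^ (γ : ℝ) := by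
    rw [mem_pBall, norm_sub_rev, ← Real.rpow_intCast] at h
    rw [← ofReal_norm, ← ENNReal.ofReal_natCast p, ENNReal.ofReal_rpow_of_pos (prime_pos p)]
    exact ENNReal.ofReal_le_ofReal h
  rw [ENNReal.rpow_mul]
  exact (enorm_sub_le_lipNorm_mul hβ g x y).trans
    (mul_le_mul' hg (ENNReal.rpow_le_rpow hnorm hβ))

lemma MemLipschitz.exists_ae_enorm_sub_le (hβ : 0 ≤ β) (h : MemLipschitz β b) :
    ∃ Λ : ℝ≥0, 0 < Λ ∧ ∀ᵐ x ∂(haar p n), ∀ γ : ℤ, ∀ᵐ y ∂((haar p n).restrict (pBall γ x)),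
      ‖b x - b y‖ₑ ≤ Λ * (p : ℝ≥0∞) ^ (γ * β) := by
  obtain ⟨g, -, hgb, hlip⟩ := h
  obtain ⟨Λ, hΛ, -⟩ := ENNReal.lt_iff_exists_nnreal_btwn.1 hlip
  refine ⟨Λ, by exact_mod_cast zero_le.trans_lt hΛ, ?_⟩
  filter_upwards [hgb] with x hx γ
  filter_upwards [ae_restrict_of_ae hgb, ae_restrict_mem (measurableSet_pBall γ x)] with y hy hmem
  rw [← hx, ← hy]
  exact enorm_sub_le_of_mem_pBall hβ hΛ.le hmem

lemma maximalCommutator_le (hn : n ≠ 0) {f : Qpn p n → ℝ} {F : Qpn p n → ℝ≥0∞} {η : ℝ≥0}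
    {Λ : ℝ≥0} {x : Qpn p n}
    (hb : ∀ γ : ℤ, ∀ᵐ y ∂((haar p n).restrict (pBall γ x)),
      ‖b x - b y‖ₑ ≤ Λ * (p : ℝ≥0∞) ^ (γ * β))
    (hf : ∀ᵐ y ∂(haar p n), ‖f y‖ₑ ≤ η * F y) :
    maximalCommutator b f x ≤ Λ * η * fractionalMaximal (β / n) F x := by
  rw [maximalCommutator_eq_iSup_setLAverage]
  refine iSup_le fun γ => ?_
  have hfin : (Λ : ℝ≥0∞) * (p : ℝ≥0∞) ^ (γ * β) * η ≠ ∞ :=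
    ENNReal.mul_ne_top (ENNReal.mul_ne_top ENNReal.coe_ne_top (prime_rpow_ne_top p _))
      ENNReal.coe_ne_top
  calc ⨍⁻ y in pBall γ x, ‖b x - b y‖ₑ * ‖f y‖ₑ ∂(haar p n)
      ≤ ⨍⁻ y in pBall γ x, Λ * (p : ℝ≥0∞) ^ (γ * β) * η * F y ∂(haar p n) := by
        refine laverage_mono_ae ?_
        filter_upwards [hb γ, ae_restrict_of_ae hf] with y hby hfy
        rw [mul_assoc]
        exact mul_le_mul' hby hfy
    _ = Λ * η * (haar p n (pBall γ x) ^ (β / n) * ⨍⁻ y in pBall γ x, F y ∂(haar p n)) := by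
        rw [setLAverage_eq, lintegral_const_mul' _ _ hfin, mul_div_assoc, ← setLAverage_eq,
          haar_pBall_rpow_div hn]
        ring
    _ ≤ _ := mul_le_mul_right (le_fractionalMaximal F γ x) _

lemma MemLipschitz.exists_modular_maximalCommutator_le (h : MemLipschitz β b) {r q : Qpn p n → ℝ}
    (hrq : AdmissiblePair β r q) :
    ∃ Λ K : ℝ≥0, 0 < Λ ∧ ∀ f : Qpn p n → ℝ, AEMeasurable f (haar p n) → ∀ η : ℝ≥0, 0 < η →
      modular r f η ≤ 1 → modular q (maximalCommutator b f) (Λ * η) ≤ K := by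
  have hβ := hrq.beta_pos
  obtain ⟨K, hKt, hK⟩ := hrq.logHolder_r.exists_lintegral_fractionalMaximal_rpow_le
    (div_nonneg hβ.le n.cast_nonneg) hrq.div_lt hrq.dim_ne_zero
  lift K to ℝ≥0 using hKt
  obtain ⟨Λ, hΛ, hlip⟩ := h.exists_ae_enorm_sub_le hβ.le
  refine ⟨Λ, K, hΛ, fun f hf η hη hmod => ?_⟩
  have hη0 : (η : ℝ≥0∞) ≠ 0 := by exact_mod_cast hη.ne'
  set F : Qpn p n → ℝ≥0∞ := fun y => ‖hf.mk f y‖ₑ / η with hF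
  have hFint : ∫⁻ y, F y ^ r y ∂(haar p n) ≤ 1 := by
    refine (lintegral_congr_ae ?_).trans_le hmod
    filter_upwards [hf.ae_eq_mk] with y hy
    rw [hF, hy]
  have hfF : ∀ᵐ y ∂(haar p n), ‖f y‖ₑ ≤ η * F y := by
    filter_upwards [hf.ae_eq_mk] with y hy
    rw [hF, hy, ENNReal.mul_div_cancel hη0 ENNReal.coe_ne_top]
  refine (lintegral_mono_ae ?_).trans (hK F (hf.measurable_mk.enorm.div_const _) hFint)
  filter_upwards [hlip] with x hx
  rw [← hrq.eq_sobolevExponent, enorm_eq_self, ENNReal.coe_mul]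
  exact ENNReal.rpow_le_rpow
    (ENNReal.div_le_of_le_mul' (maximalCommutator_le hrq.dim_ne_zero hx hfF))
    (zero_le_one.trans (hrq.logHolder_q.isExponent.one_lt x).le)

theorem MemLipschitz.commutatorBounded (hb : AEMeasurable b (haar p n)) (h : MemLipschitz β b)
    {r q : Qpn p n → ℝ} (hrq : AdmissiblePair β r q) : CommutatorBounded b r q := by
  have hr := fun x => (hrq.logHolder_r.isExponent.one_lt x).le
  have hq := fun x => (hrq.logHolder_q.isExponent.one_lt x).le
  obtain ⟨Λ, K, hΛ, hmod⟩ := h.exists_modular_maximalCommutator_le hrq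
  refine ⟨max 1 K * Λ, fun f hf => ⟨⟨?_, ?_⟩, ?_⟩⟩
  · exact (aemeasurable_maximalCommutator hb hf.1.aemeasurable).aestronglyMeasurable
  · obtain ⟨η, hη, hη1⟩ := hf.exists_modular_le_one hr
    exact ⟨Λ * η, mul_pos hΛ hη, (hmod f hf.1.aemeasurable η hη hη1).trans_lt ENNReal.coe_lt_top⟩
  · refine luxNorm_le_mul (mul_pos (one_pos.trans_le (le_max_left _ _)) hΛ) fun η hη hη1 => ?_
    rw [mul_assoc]
    exact modular_max_one_mul_le_one hq (hmod f hf.1.aemeasurable η hη hη1)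

theorem MemLipschitz.oscillation_lt_top (hn : n ≠ 0) (hβ : 0 ≤ β)
    (hb : LocallyIntegrable b (haar p n)) (h : MemLipschitz β b) {q : Qpn p n → ℝ}
    (hq : ∀ y, 0 ≤ q y) : oscillation β b q < ∞ := by
  obtain ⟨Λ, hΛ, hlip⟩ := h.exists_ae_enorm_sub_le hβ
  refine (iSup₂_le fun γ x => ?_).trans_lt (ENNReal.coe_lt_top (r := Λ))
  rw [haar_pBall_rpow_div hn, ← ENNReal.div_eq_inv_mul]
  refine ENNReal.div_le_of_le_mul (ENNReal.div_le_of_le_mul ?_)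
  refine luxNorm_le_mul_of_enorm_le hq
    (mul_ne_zero (by exact_mod_cast hΛ.ne') (prime_rpow_ne_zero p _))
    (ENNReal.mul_ne_top ENNReal.coe_ne_top (prime_rpow_ne_top p _)) ?_
  filter_upwards [hlip] with y hy
  by_cases hmem : y ∈ pBall γ x
  · rw [indicator_of_mem hmem, indicator_of_mem hmem, enorm_one, mul_one]
    refine (enorm_sub_average_le (integrableOn_pBall hb γ x) _).trans
      ((laverage_mono_ae ?_).trans_eq (laverage_const _ _))
    have hyγ := hy γ
    rwa [pBall_eq_of_mem hmem] at hyγ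
  · rw [indicator_of_notMem hmem, enorm_zero]
    exact zero_le

end Lipschitz

section ReferenceExponents

lemma modular_indicator_pBall {q : Qpn p n → ℝ} (hq : ∀ y, 0 < q y) (f : Qpn p n → ℝ) (γ : ℤ)
    (a : Qpn p n) (η : ℝ≥0) :
    modular q ((pBall γ a).indicator f) η = ∫⁻ y in pBall γ a, (‖f y‖ₑ / η) ^ q y ∂(haar p n) := by
  rw [modular, ← lintegral_indicator (measurableSet_pBall γ a)]
  refine lintegral_congr fun y => ?_
  by_cases hy : y ∈ pBall γ a
  · rw [indicator_of_mem hy, indicator_of_mem hy]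
  · rw [indicator_of_notMem hy, indicator_of_notMem hy, enorm_zero, ENNReal.zero_div,
      ENNReal.zero_rpow_of_pos (hq y)]

lemma memLvar_indicator_pBall {q : Qpn p n → ℝ} (hq : ∀ y, 0 < q y) (γ : ℤ) (a : Qpn p n) :
    MemLvar q ((pBall γ a).indicator fun _ => (1 : ℝ)) := by
  refine ⟨(measurable_const.indicator (measurableSet_pBall γ a)).aestronglyMeasurable, 1,
    one_pos, ?_⟩
  simp only [modular_indicator_pBall hq, enorm_one, ENNReal.coe_one, div_one, ENNReal.one_rpow,
    setLIntegral_const, one_mul]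
  exact (haar_pBall_ne_top γ a).lt_top

variable {s C : ℝ}

lemma exists_forall_setLIntegral_rpow_le (hs : 0 < s) (hC : 0 ≤ C) :
    ∃ K : ℝ≥0, ∀ (γ : ℤ) (a : Qpn p n) (q : Qpn p n → ℝ) (q₀ : ℝ),
      IsRefExponent C γ a q q₀ → (∀ y, s ≤ q y) → s ≤ q₀ →
      ∫⁻ y in pBall γ a, ((p : ℝ≥0∞) ^ (-(n * γ / q₀))) ^ q y ∂(haar p n) ≤ K := by
  refine ⟨((p : ℝ≥0∞) ^ ((n + 1) * C / s) +
    ∫⁻ y, decayWeight (p := p) (n := n) y ∂(haar p n)).toNNReal, fun γ a q q₀ href hq hq₀ => ?_⟩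
  rw [ENNReal.coe_toNNReal (ENNReal.add_ne_top.2
    ⟨prime_rpow_ne_top p _, lintegral_decayWeight_lt_top.ne⟩)]
  exact href.setLIntegral_rpow_le hs hC hq hq₀

lemma exists_luxNorm_indicator_pBall_le (hC : 0 ≤ C) :
    ∃ K : ℝ≥0, 0 < K ∧ ∀ (γ : ℤ) (a : Qpn p n) (q : Qpn p n → ℝ) (q₀ : ℝ),
      IsRefExponent C γ a q q₀ → (∀ y, 1 ≤ q y) → 1 ≤ q₀ →
      luxNorm q ((pBall γ a).indicator fun _ => (1 : ℝ)) ≤ K * (p : ℝ≥0∞) ^ (n * γ / q₀) := by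
  obtain ⟨K, hK⟩ := exists_forall_setLIntegral_rpow_le (p := p) (n := n) one_pos hC
  have hK1 : 0 < max 1 K := one_pos.trans_le (le_max_left _ _)
  refine ⟨max 1 K, hK1, fun γ a q q₀ href hq hq₀ => ?_⟩
  set η : ℝ≥0 := ((p : ℝ≥0∞) ^ (n * γ / q₀)).toNNReal
  have hη : (η : ℝ≥0∞) = (p : ℝ≥0∞) ^ (n * γ / q₀) := ENNReal.coe_toNNReal (prime_rpow_ne_top p _)
  rw [← hη, ← ENNReal.coe_mul]
  refine luxNorm_le (mul_pos hK1
    (ENNReal.toNNReal_pos (prime_rpow_ne_zero p _) (prime_rpow_ne_top p _)))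
    (modular_max_one_mul_le_one hq ?_)
  simpa only [modular_indicator_pBall fun y => one_pos.trans_le (hq y), enorm_one, one_div, hη,
    ← ENNReal.rpow_neg] using hK γ a q q₀ href hq hq₀

lemma mul_le_rpow_add_rpow {s t : ℝ} (hst : s.HolderConjugate t) (a b : ℝ≥0∞) :
    a * b ≤ a ^ s + b ^ t := by
  have hdiv {u : ℝ} (hu : 1 < u) (c : ℝ≥0∞) : c / ENNReal.ofReal u ≤ c :=
    ENNReal.div_le_of_le_mul (le_mul_of_one_le_right' (ENNReal.one_le_ofReal.2 hu.le))
  exact (ENNReal.young_inequality a b hst).trans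
    (add_le_add (hdiv hst.lt _) (hdiv hst.symm.lt _))

lemma measurable_conjExponent : Measurable Real.conjExponent := by
  unfold Real.conjExponent
  fun_prop

lemma exists_setLAverage_le_of_setLIntegral_rpow_le_one (hs : 1 < s) (hC : 0 ≤ C) :
    ∃ K : ℝ≥0, 0 < K ∧ ∀ (γ : ℤ) (a : Qpn p n) (q : Qpn p n → ℝ) (q₀ : ℝ),
      IsRefExponent C γ a q q₀ → Measurable q → (∀ y, s ≤ q y) → s ≤ q₀ → ∀ h : Qpn p n → ℝ≥0∞,
      ∫⁻ y in pBall γ a, h y ^ q y ∂(haar p n) ≤ 1 →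
      ⨍⁻ y in pBall γ a, h y ∂(haar p n) ≤ K * (p : ℝ≥0∞) ^ (-(n * γ / q₀)) := by
  obtain ⟨K, hK⟩ := exists_forall_setLIntegral_rpow_le (p := p) (n := n) one_pos
    (mul_nonneg (inv_nonneg.2 (sq_nonneg (s - 1))) hC)
  refine ⟨1 + K, by positivity, fun γ a q q₀ href hqm hq hq₀ h hint => ?_⟩
  have hconj : ∀ t, s ≤ t → t.HolderConjugate t.conjExponent := fun t ht =>
    Real.HolderConjugate.conjExponent (hs.trans_le ht)
  set τ : ℝ≥0∞ := (p : ℝ≥0∞) ^ (-(n * γ / q₀.conjExponent))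
  have hτint : ∫⁻ y in pBall γ a, τ ^ (q y).conjExponent ∂(haar p n) ≤ K :=
    hK γ a (fun y => (q y).conjExponent) q₀.conjExponent
      (href.of_abs_sub_le (by positivity) fun y => abs_conjExponent_sub_le hs (hq y) hq₀)
      (fun y => (hconj _ (hq y)).symm.lt.le) (hconj _ hq₀).symm.lt.le
  have hyoung : (∫⁻ y in pBall γ a, h y ∂(haar p n)) * τ ≤ 1 + K := by
    rw [← lintegral_mul_const' _ _ (prime_rpow_ne_top p _)]
    calc ∫⁻ y in pBall γ a, h y * τ ∂(haar p n)
        ≤ ∫⁻ y in pBall γ a, (h y ^ q y + τ ^ (q y).conjExponent) ∂(haar p n) :=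
          lintegral_mono fun y => mul_le_rpow_add_rpow (hconj _ (hq y)) _ _
      _ ≤ 1 + K := by
          have hτm : Measurable fun y => τ ^ (q y).conjExponent :=
            measurable_const.pow (measurable_conjExponent.comp hqm)
          rw [lintegral_add_right _ hτm]
          exact add_le_add hint hτint
  have hvol : (haar p n (pBall γ a))⁻¹ = τ * (p : ℝ≥0∞) ^ (-(n * γ / q₀)) := by
    rw [haar_pBall, ← prime_rpow_add, ← ENNReal.rpow_neg]
    congr 1
    linear_combination (n * γ : ℝ) * (hconj _ hq₀).inv_add_inv_eq_one
  rw [setLAverage_eq, div_eq_mul_inv, hvol, ← mul_assoc, ENNReal.coe_add, ENNReal.coe_one]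
  exact mul_le_mul_left hyoung _

lemma exists_setLAverage_enorm_le_mul_luxNorm (hs : 1 < s) (hC : 0 ≤ C) :
    ∃ K : ℝ≥0, ∀ (γ : ℤ) (a : Qpn p n) (q : Qpn p n → ℝ) (q₀ : ℝ),
      IsRefExponent C γ a q q₀ → Measurable q → (∀ y, s ≤ q y) → s ≤ q₀ → ∀ f : Qpn p n → ℝ,
      ⨍⁻ y in pBall γ a, ‖f y‖ₑ ∂(haar p n) ≤
        K * (p : ℝ≥0∞) ^ (-(n * γ / q₀)) * luxNorm q ((pBall γ a).indicator f) := by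
  obtain ⟨K, hK0, hK⟩ := exists_setLAverage_le_of_setLIntegral_rpow_le_one (p := p) (n := n) hs hC
  refine ⟨K, fun γ a q q₀ href hqm hq hq₀ f => ?_⟩
  have hc0 : (K : ℝ≥0∞) * (p : ℝ≥0∞) ^ (-(n * γ / q₀)) ≠ 0 :=
    mul_ne_zero (by exact_mod_cast hK0.ne') (prime_rpow_ne_zero p _)
  have hct : (K : ℝ≥0∞) * (p : ℝ≥0∞) ^ (-(n * γ / q₀)) ≠ ∞ :=
    ENNReal.mul_ne_top ENNReal.coe_ne_top (prime_rpow_ne_top p _)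
  simp only [luxNorm, ENNReal.mul_iInf_of_ne hc0 hct]
  refine le_iInf₂ fun η ⟨hη, hmod⟩ => ?_
  have hη0 : (η : ℝ≥0∞) ≠ 0 := by exact_mod_cast hη.ne'
  rw [modular_indicator_pBall fun y => zero_lt_one.trans (hs.trans_le (hq y))] at hmod
  calc ⨍⁻ y in pBall γ a, ‖f y‖ₑ ∂(haar p n)
      = (⨍⁻ y in pBall γ a, ‖f y‖ₑ / η ∂(haar p n)) * η := by
        simp only [setLAverage_eq, div_eq_mul_inv]
        rw [lintegral_mul_const' _ _ (ENNReal.inv_ne_top.2 hη0), mul_right_comm,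
          mul_assoc (lintegral _ _), ENNReal.inv_mul_cancel hη0 ENNReal.coe_ne_top, mul_one]
    _ ≤ _ := mul_le_mul_left (hK γ a q q₀ href hqm hq hq₀ _ hmod) _

lemma exists_rpow_le_mul_luxNorm_indicator_pBall (hs : 1 < s) (hC : 0 ≤ C) :
    ∃ K : ℝ≥0, ∀ (γ : ℤ) (a : Qpn p n) (q : Qpn p n → ℝ) (q₀ : ℝ),
      IsRefExponent C γ a q q₀ → Measurable q → (∀ y, s ≤ q y) → s ≤ q₀ →
      (p : ℝ≥0∞) ^ (n * γ / q₀) ≤ K * luxNorm q ((pBall γ a).indicator fun _ => (1 : ℝ)) := by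
  obtain ⟨K, hK⟩ := exists_setLAverage_enorm_le_mul_luxNorm (p := p) (n := n) hs hC
  refine ⟨K, fun γ a q q₀ href hqm hq hq₀ => ?_⟩
  have hone := hK γ a q q₀ href hqm hq hq₀ fun _ => 1
  rwa [laverage_const, enorm_one, ENNReal.rpow_neg, mul_right_comm, ← div_eq_mul_inv,
    ENNReal.le_div_iff_mul_le (Or.inl (prime_rpow_ne_zero p _)) (Or.inl (prime_rpow_ne_top p _)),
    one_mul] at hone

end ReferenceExponents

section Oscillation

variable {β : ℝ} {b r q : Qpn p n → ℝ}

lemma AdmissiblePair.exists_isRefExponent (h : AdmissiblePair β r q) :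
    ∃ s C : ℝ, 1 < s ∧ 0 ≤ C ∧ (∀ y, s ≤ r y) ∧ (∀ y, s ≤ q y) ∧ ∀ (γ : ℤ) (a : Qpn p n),
      ∃ r₀ q₀ : ℝ, s ≤ r₀ ∧ s ≤ q₀ ∧ 1 / r₀ = β / n + 1 / q₀ ∧
        IsRefExponent C γ a r r₀ ∧ IsRefExponent C γ a q q₀ := by
  have hexp := h.logHolder_r.isExponent
  have hs := hexp.one_lt_essInf
  have hα : 0 ≤ β / n := div_nonneg h.beta_pos.le n.cast_nonneg
  obtain ⟨C, hC, href⟩ := h.logHolder_r.exists_isRefExponent h.dim_ne_zero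
  set s := essInf r (haar p n)
  set R := essSup r (haar p n)
  set L := max 1 (sobolevExponent (β / n) R ^ 2)
  have hL : 0 ≤ L := zero_le_one.trans (le_max_left _ _)
  have hsob : ∀ t ∈ Icc s R, s ≤ sobolevExponent (β / n) t := fun t ht =>
    ht.1.trans (le_sobolevExponent hα (by linarith [ht.1]) (h.logHolder_r.lt_one_div h.div_lt ht))
  refine ⟨s, L * C, hs, mul_nonneg hL hC, hexp.essInf_le, fun y => ?_, fun γ a => ?_⟩
  · rw [h.eq_sobolevExponent]
    exact hsob _ (hexp.mem_Icc y)
  · obtain ⟨r₀, hr₀, hr₀ref⟩ := href γ a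
    refine ⟨r₀, sobolevExponent (β / n) r₀, hr₀.1, hsob r₀ hr₀, ?_,
      hr₀ref.of_abs_sub_le hL fun y => le_mul_of_one_le_left (abs_nonneg _) (le_max_left _ _),
      hr₀ref.of_abs_sub_le hL fun y => ?_⟩
    · rw [one_div_sobolevExponent]
      ring
    · rw [h.eq_sobolevExponent]
      exact (abs_sobolevExponent_sub_le (hexp.one_lt y).le (hs.le.trans hr₀.1) (hexp.le_essSup y)
        hr₀.2 h.div_lt).trans (mul_le_mul_of_nonneg_right (le_max_right _ _) (abs_nonneg _))

lemma AdmissiblePair.exists_luxNorm_indicator_pBall_le (h : AdmissiblePair β r q) :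
    ∃ K : ℝ≥0, ∀ (γ : ℤ) (a : Qpn p n),
      luxNorm r ((pBall γ a).indicator fun _ => (1 : ℝ)) ≤
        K * (p : ℝ≥0∞) ^ (γ * β) * luxNorm q ((pBall γ a).indicator fun _ => (1 : ℝ)) := by
  obtain ⟨s, C, hs, hC, hsr, hsq, href⟩ := h.exists_isRefExponent
  obtain ⟨K₁, -, hK₁⟩ := PadicVar.exists_luxNorm_indicator_pBall_le (p := p) (n := n) hC
  obtain ⟨K₂, hK₂⟩ := exists_rpow_le_mul_luxNorm_indicator_pBall (p := p) (n := n) hs hC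
  refine ⟨K₁ * K₂, fun γ a => ?_⟩
  obtain ⟨r₀, q₀, hr₀, hq₀, hrel, hrefr, hrefq⟩ := href γ a
  have hn : (n : ℝ) ≠ 0 := by exact_mod_cast h.dim_ne_zero
  have hexp : n * γ / r₀ = γ * β + n * γ / q₀ := by
    rw [div_eq_mul_one_div (n * γ : ℝ) r₀, hrel]
    field_simp
  calc luxNorm r ((pBall γ a).indicator fun _ => (1 : ℝ))
      ≤ K₁ * (p : ℝ≥0∞) ^ (n * γ / r₀) :=
        hK₁ γ a r r₀ hrefr (fun y => hs.le.trans (hsr y)) (hs.le.trans hr₀)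
    _ = K₁ * (p : ℝ≥0∞) ^ (γ * β) * (p : ℝ≥0∞) ^ (n * γ / q₀) := by
        rw [hexp, prime_rpow_add, mul_assoc]
    _ ≤ K₁ * (p : ℝ≥0∞) ^ (γ * β) *
          (K₂ * luxNorm q ((pBall γ a).indicator fun _ => (1 : ℝ))) :=
        mul_le_mul_right (hK₂ γ a q q₀ hrefq h.logHolder_q.isExponent.measurable hsq hq₀) _
    _ = _ := by
        push_cast
        ring

lemma AdmissiblePair.exists_setLAverage_enorm_le (h : AdmissiblePair β r q) :
    ∃ K : ℝ≥0, ∀ (γ : ℤ) (a : Qpn p n) (f : Qpn p n → ℝ),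
      ⨍⁻ y in pBall γ a, ‖f y‖ₑ ∂(haar p n) ≤
        K * (luxNorm q ((pBall γ a).indicator f) /
          luxNorm q ((pBall γ a).indicator fun _ => (1 : ℝ))) := by
  obtain ⟨s, C, hs, hC, -, hsq, href⟩ := h.exists_isRefExponent
  obtain ⟨K₁, hK₁0, hK₁⟩ := PadicVar.exists_luxNorm_indicator_pBall_le (p := p) (n := n) hC
  obtain ⟨K₂, hK₂⟩ := exists_setLAverage_enorm_le_mul_luxNorm (p := p) (n := n) hs hC
  refine ⟨K₂ * K₁, fun γ a f => ?_⟩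
  obtain ⟨-, q₀, -, hq₀, -, -, hrefq⟩ := href γ a
  set N := luxNorm q ((pBall γ a).indicator fun _ => (1 : ℝ))
  have hN : (p : ℝ≥0∞) ^ (-(n * γ / q₀)) ≤ K₁ / N := by
    rw [ENNReal.le_div_iff_mul_le (Or.inr (by exact_mod_cast hK₁0.ne'))
      (Or.inr ENNReal.coe_ne_top), ENNReal.rpow_neg, ← ENNReal.div_eq_inv_mul]
    exact ENNReal.div_le_of_le_mul
      (hK₁ γ a q q₀ hrefq (fun y => hs.le.trans (hsq y)) (hs.le.trans hq₀))
  calc ⨍⁻ y in pBall γ a, ‖f y‖ₑ ∂(haar p n)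
      ≤ K₂ * (p : ℝ≥0∞) ^ (-(n * γ / q₀)) * luxNorm q ((pBall γ a).indicator f) :=
        hK₂ γ a q q₀ hrefq h.logHolder_q.isExponent.measurable hsq hq₀ f
    _ ≤ K₂ * (K₁ / N) * luxNorm q ((pBall γ a).indicator f) := by gcongr
    _ = _ := by
        push_cast
        simp only [div_eq_mul_inv]
        ring

lemma luxNorm_indicator_sub_average_le (hb : LocallyIntegrable b (haar p n)) (hq : ∀ y, 0 ≤ q y)
    (γ : ℤ) (x : Qpn p n) :
    luxNorm q ((pBall γ x).indicator fun y => b y - ⨍ z in pBall γ x, b z ∂(haar p n)) ≤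
      luxNorm q (maximalCommutator b ((pBall γ x).indicator fun _ => (1 : ℝ))) := by
  rw [← one_mul (luxNorm q (maximalCommutator _ _))]
  refine luxNorm_le_mul_of_enorm_le hq one_ne_zero ENNReal.one_ne_top (ae_of_all _ fun y => ?_)
  rw [one_mul, enorm_eq_self, maximalCommutator_eq_iSup_setLAverage]
  by_cases hy : y ∈ pBall γ x
  · rw [indicator_of_mem hy]
    refine (enorm_sub_average_le (integrableOn_pBall hb γ x) _).trans (le_iSup_of_le γ ?_)
    rw [pBall_eq_of_mem hy]
    refine (setLAverage_congr_fun (measurableSet_pBall γ x) fun z hz => ?_).le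
    rw [indicator_of_mem hz, enorm_one, mul_one]
  · rw [indicator_of_notMem hy, enorm_zero]
    exact zero_le

theorem CommutatorBounded.oscillation_lt_top (hb : LocallyIntegrable b (haar p n))
    (hrq : AdmissiblePair β r q) (h : CommutatorBounded b r q) : oscillation β b q < ∞ := by
  obtain ⟨A, hA⟩ := h
  obtain ⟨K, hK⟩ := hrq.exists_luxNorm_indicator_pBall_le
  have hr := fun y => zero_lt_one.trans (hrq.logHolder_r.isExponent.one_lt y)
  have hq := fun y => (zero_lt_one.trans (hrq.logHolder_q.isExponent.one_lt y)).le
  refine (iSup₂_le fun γ x => ?_).trans_lt (ENNReal.coe_lt_top (r := A * K))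
  rw [haar_pBall_rpow_div hrq.dim_ne_zero, ← ENNReal.div_eq_inv_mul]
  refine ENNReal.div_le_of_le_mul (ENNReal.div_le_of_le_mul ?_)
  calc luxNorm q ((pBall γ x).indicator fun y => b y - ⨍ z in pBall γ x, b z ∂(haar p n))
      ≤ luxNorm q (maximalCommutator b ((pBall γ x).indicator fun _ => (1 : ℝ))) :=
        luxNorm_indicator_sub_average_le hb hq γ x
    _ ≤ A * luxNorm r ((pBall γ x).indicator fun _ => (1 : ℝ)) :=
        (hA _ (memLvar_indicator_pBall hr γ x)).2
    _ ≤ A * (K * (p : ℝ≥0∞) ^ (γ * β) * luxNorm q ((pBall γ x).indicator fun _ => (1 : ℝ))) :=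
        mul_le_mul_right (hK γ x) _
    _ = _ := by
        push_cast
        ring

lemma AdmissiblePair.exists_setLAverage_sub_average_le (h : AdmissiblePair β r q) :
    ∃ K : ℝ≥0, ∀ (γ : ℤ) (x : Qpn p n),
      ⨍⁻ y in pBall γ x, ‖b y - ⨍ z in pBall γ x, b z ∂(haar p n)‖ₑ ∂(haar p n) ≤
        K * oscillation β b q * (p : ℝ≥0∞) ^ (γ * β) := by
  obtain ⟨K, hK⟩ := h.exists_setLAverage_enorm_le
  refine ⟨K, fun γ x => (hK γ x _).trans ?_⟩
  rw [mul_assoc]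
  refine mul_le_mul_right ?_ _
  rw [← ENNReal.div_le_iff (prime_rpow_ne_zero p _) (prime_rpow_ne_top p _),
    ENNReal.div_eq_inv_mul, ← haar_pBall_rpow_div h.dim_ne_zero β γ x]
  exact le_iSup₂_of_le (f := fun γ x => ((haar p n (pBall γ x)) ^ (β / n))⁻¹ * (luxNorm q
    ((pBall γ x).indicator fun y => b y - ⨍ z in pBall γ x, b z ∂(haar p n)) /
      luxNorm q ((pBall γ x).indicator fun _ => (1 : ℝ)))) γ x le_rfl

end Oscillation

section GeometricSequences

variable {E : Type*} [MetricSpace E] [CompleteSpace E] {u : ℤ → E} {a β M : ℝ}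

lemma exists_tendsto_atBot_of_dist_le (ha : 1 < a) (hβ : 0 < β)
    (h : ∀ γ, dist (u γ) (u (γ - 1)) ≤ M * a ^ (γ * β)) :
    ∃ l, Tendsto u atBot (𝓝 l) ∧ ∀ γ, dist (u γ) l ≤ M / (1 - a ^ (-β)) * a ^ (γ * β) := by
  have ha0 : 0 < a := zero_lt_one.trans ha
  have hρ : a ^ (-β) < 1 := Real.rpow_lt_one_of_one_lt_of_neg ha (neg_lt_zero.2 hβ)
  have hstep : ∀ γ (k : ℕ), dist (u (γ - k)) (u (γ - (k + 1 : ℕ))) ≤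
      M * a ^ (γ * β) * (a ^ (-β)) ^ k := fun γ k => by
    rw [← Real.rpow_mul_natCast ha0.le, mul_assoc, ← Real.rpow_add ha0]
    convert h (γ - k) using 3
    · push_cast
      ring_nf
    · push_cast
      ring
  obtain ⟨l, hl⟩ := cauchySeq_tendsto_of_complete (cauchySeq_of_le_geometric _ _ hρ (hstep 0))
  have hbot : Tendsto u atBot (𝓝 l) := by
    rw [← map_neg_atTop, ← Nat.map_cast_int_atTop, map_map, tendsto_map'_iff]
    simpa only [Function.comp_def, zero_sub] using hl
  refine ⟨l, hbot, fun γ => ?_⟩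
  have hsub : Tendsto (fun k : ℕ => γ - (k : ℤ)) atTop atBot :=
    tendsto_const_nhds.add_atBot (tendsto_neg_atTop_atBot.comp tendsto_natCast_atTop_atTop)
  have hdist := dist_le_of_le_geometric_of_tendsto₀ _ _ hρ (hstep γ) (hbot.comp hsub)
  rwa [Nat.cast_zero, sub_zero, mul_div_right_comm] at hdist

end GeometricSequences

section Campanato

variable {β : ℝ} {b f : Qpn p n → ℝ}

lemma exists_norm_eq_zpow {x : Qpn p n} (hx : x ≠ 0) : ∃ γ : ℤ, ‖x‖ = (p : ℝ) ^ γ := by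
  obtain ⟨i, hi⟩ : ∃ i, ‖x i‖ = ‖x‖ := by
    have : Nonempty (Fin n) := by
      by_contra hn
      exact hx (funext fun i => (hn ⟨i⟩).elim)
    obtain ⟨i, -, hi⟩ := Finset.exists_mem_eq_sup Finset.univ Finset.univ_nonempty fun i => ‖x i‖₊
    exact ⟨i, by rw [Pi.norm_def, hi, coe_nnnorm]⟩
  have hxi : x i ≠ 0 := by
    rw [← norm_ne_zero_iff, hi]
    exact norm_ne_zero_iff.2 hx
  exact ⟨-(x i).valuation, by rw [← hi, Padic.norm_eq_zpow_neg_valuation hxi]⟩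

lemma lipNorm_le {M : ℝ≥0∞}
    (h : ∀ γ, ∀ x, ∀ y ∈ pBall γ x, ‖f x - f y‖ₑ ≤ M * (p : ℝ≥0∞) ^ (γ * β)) :
    lipNorm β f ≤ M := by
  refine iSup₂_le fun x y => iSup_le fun hxy => ENNReal.div_le_of_le_mul ?_
  obtain ⟨γ, hγ⟩ := exists_norm_eq_zpow (sub_ne_zero.2 hxy)
  have henorm : ‖x - y‖ₑ = (p : ℝ≥0∞) ^ (γ : ℝ) := by
    rw [← ofReal_norm, hγ, ← Real.rpow_intCast, ← ENNReal.ofReal_rpow_of_pos (prime_pos p),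
      ENNReal.ofReal_natCast]
  rw [henorm, ← ENNReal.rpow_mul]
  exact h γ x y (by rw [mem_pBall, norm_sub_rev, hγ])

lemma continuous_of_lipNorm_lt_top (hβ : 0 < β) (h : lipNorm β f < ∞) : Continuous f := by
  have hholder : HolderWith (lipNorm β f).toNNReal β.toNNReal f := fun x y => by
    rw [edist_eq_enorm_sub, edist_eq_enorm_sub, ENNReal.coe_toNNReal h.ne,
      Real.coe_toNNReal β hβ.le]
    exact enorm_sub_le_lipNorm_mul hβ.le f x y
  exact hholder.continuous (Real.toNNReal_pos.2 hβ)

lemma ae_tendsto_setAverage_pBall (hb : LocallyIntegrable b (haar p n)) :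
    ∀ᵐ x ∂(haar p n), Tendsto (fun γ : ℤ => ⨍ z in pBall γ x, b z ∂(haar p n)) atBot
      (𝓝 (b x)) := by
  have hrad : Tendsto (fun γ : ℤ => (p : ℝ) ^ γ) atBot (𝓝[>] 0) := by
    refine tendsto_nhdsWithin_iff.2 ⟨?_, Eventually.of_forall fun γ => zpow_pos (prime_pos p) γ⟩
    simpa only [Function.comp_def, Real.rpow_intCast, id_eq] using
      (tendsto_rpow_atBot_of_base_gt_one _ (one_lt_prime p)).comp
        (tendsto_intCast_atBot_iff.2 tendsto_id)
  filter_upwards [IsUnifLocDoublingMeasure.ae_tendsto_average (haar p n) hb 1] with x hx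
  exact hx _ _ hrad (Eventually.of_forall fun γ => mem_closedBall_self
    (by have := prime_pos p; positivity))

lemma setLAverage_pBall_sub_one_le (G : Qpn p n → ℝ≥0∞) (γ : ℤ) (x : Qpn p n) :
    ⨍⁻ y in pBall (γ - 1) x, G y ∂(haar p n) ≤
      (p : ℝ≥0∞) ^ (n : ℝ) * ⨍⁻ y in pBall γ x, G y ∂(haar p n) := by
  have hvol : (haar p n (pBall (γ - 1) x))⁻¹ = (p : ℝ≥0∞) ^ (n : ℝ) * (haar p n (pBall γ x))⁻¹ := by
    rw [haar_pBall, haar_pBall, ← ENNReal.rpow_neg, ← ENNReal.rpow_neg, ← prime_rpow_add]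
    push_cast
    ring_nf
  rw [setLAverage_eq, setLAverage_eq, ENNReal.div_eq_inv_mul, ENNReal.div_eq_inv_mul, hvol,
    mul_assoc]
  gcongr
  exact pBall_mono (Int.sub_le_self γ zero_le_one) x

lemma enorm_setAverage_sub_setAverage_le (hb : LocallyIntegrable b (haar p n)) (γ : ℤ)
    (x : Qpn p n) :
    ‖(⨍ z in pBall γ x, b z ∂(haar p n)) - ⨍ z in pBall (γ - 1) x, b z ∂(haar p n)‖ₑ ≤
      (p : ℝ≥0∞) ^ (n : ℝ) *
        ⨍⁻ y in pBall γ x, ‖b y - ⨍ z in pBall γ x, b z ∂(haar p n)‖ₑ ∂(haar p n) := by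
  refine (enorm_sub_average_le (integrableOn_pBall hb _ x) _).trans ?_
  simp only [enorm_sub_rev (⨍ z in pBall γ x, b z ∂(haar p n))]
  exact setLAverage_pBall_sub_one_le _ γ x

lemma dist_setAverage_setAverage_le (hb : LocallyIntegrable b (haar p n)) {A : ℝ≥0} {γ : ℤ}
    {x : Qpn p n} (hA : ⨍⁻ y in pBall γ x, ‖b y - ⨍ z in pBall γ x, b z ∂(haar p n)‖ₑ ∂(haar p n) ≤
      A * (p : ℝ≥0∞) ^ (γ * β)) :
    dist (⨍ z in pBall γ x, b z ∂(haar p n)) (⨍ z in pBall (γ - 1) x, b z ∂(haar p n)) ≤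
      (p : ℝ) ^ (n : ℝ) * A * (p : ℝ) ^ (γ * β) := by
  have henorm := (enorm_setAverage_sub_setAverage_le hb γ x).trans (mul_le_mul_right hA _)
  have hfin : (p : ℝ≥0∞) ^ (n : ℝ) * (A * (p : ℝ≥0∞) ^ (γ * β)) ≠ ∞ :=
    ENNReal.mul_ne_top (prime_rpow_ne_top p _)
      (ENNReal.mul_ne_top ENNReal.coe_ne_top (prime_rpow_ne_top p _))
  rw [dist_eq_norm, ← toReal_enorm]
  refine (ENNReal.toReal_mono hfin henorm).trans_eq ?_
  simp only [ENNReal.toReal_mul, ← ENNReal.toReal_rpow, ENNReal.toReal_natCast,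
    ENNReal.coe_toReal, mul_assoc]

lemma lipNorm_lt_top_of_dist_le {u : ℤ → Qpn p n → ℝ} {S : ℝ} (hS : 0 ≤ S)
    (hu : ∀ γ x, ∀ y ∈ pBall γ x, u γ y = u γ x)
    (h : ∀ γ x, dist (u γ x) (f x) ≤ S * (p : ℝ) ^ (γ * β)) : lipNorm β f < ∞ := by
  refine (lipNorm_le (M := ENNReal.ofReal (2 * S)) fun γ x y hy => ?_).trans_lt
    ENNReal.ofReal_lt_top
  have hdist : dist (f x) (f y) ≤ 2 * S * (p : ℝ) ^ (γ * β) := by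
    have hx := h γ x
    have hy' := h γ y
    rw [hu γ x y hy] at hy'
    linarith [dist_triangle_left (f x) (f y) (u γ x)]
  rw [← edist_eq_enorm_sub, edist_dist, ← ENNReal.ofReal_natCast p,
    ENNReal.ofReal_rpow_of_pos (prime_pos p), ← ENNReal.ofReal_mul (by positivity)]
  exact ENNReal.ofReal_le_ofReal hdist

theorem memLipschitz_of_setLAverage_sub_average_le (hβ : 0 < β)
    (hb : LocallyIntegrable b (haar p n)) {A : ℝ≥0}
    (hA : ∀ γ x, ⨍⁻ y in pBall γ x, ‖b y - ⨍ z in pBall γ x, b z ∂(haar p n)‖ₑ ∂(haar p n) ≤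
      A * (p : ℝ≥0∞) ^ (γ * β)) : MemLipschitz β b := by
  set u : Qpn p n → ℤ → ℝ := fun x γ => ⨍ z in pBall γ x, b z ∂(haar p n)
  choose f hlim hclose using fun x => exists_tendsto_atBot_of_dist_le (u := u x) (one_lt_prime p) hβ
    fun γ => dist_setAverage_setAverage_le hb (hA γ x)
  have hρ : (p : ℝ) ^ (-β) < 1 :=
    Real.rpow_lt_one_of_one_lt_of_neg (one_lt_prime p) (neg_lt_zero.2 hβ)
  have hS : 0 ≤ (p : ℝ) ^ (n : ℝ) * A / (1 - (p : ℝ) ^ (-β)) :=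
    div_nonneg (by positivity) (sub_nonneg.2 hρ.le)
  have hlip : lipNorm β f < ∞ := lipNorm_lt_top_of_dist_le (u := fun γ x => u x γ) hS
    (fun γ x y hy => by simp only [u, pBall_eq_of_mem hy]) fun γ x => hclose x γ
  refine ⟨f, (continuous_of_lipNorm_lt_top hβ hlip).measurable, ?_, hlip⟩
  filter_upwards [ae_tendsto_setAverage_pBall hb] with x hx
  exact tendsto_nhds_unique (hlim x) hx

end Campanato

section ConstantExponent

lemma isLogHolder_const {t : ℝ} (ht : 1 < t) : IsLogHolder (fun _ : Qpn p n => t) := by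
  refine ⟨⟨measurable_const, ⟨t, by rintro _ ⟨_, rfl⟩; exact le_rfl⟩, ?_, ?_, ?_⟩,
    ⟨0, fun γ x => ?_⟩, ⟨0, fun x y => ?_⟩⟩
  · rwa [essInf_const']
  · exact fun _ => (essInf_const' t).le
  · exact fun _ => (essSup_const' t).ge
  · rw [essInf_const', essSup_const', sub_self, mul_zero]
  · rw [sub_self, abs_zero, zero_div]

lemma exists_admissiblePair {β : ℝ} (hβ0 : 0 < β) (hβn : β < n) :
    ∃ r q : Qpn p n → ℝ, AdmissiblePair β r q := by
  obtain ⟨t, ht1, htn⟩ := exists_between ((one_lt_div hβ0).2 hβn)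
  have ht0 : 0 < t := zero_lt_one.trans ht1
  have hα : β / n < 1 / t := by
    rw [← inv_div, ← one_div]
    exact one_div_lt_one_div_of_lt ht0 htn
  refine ⟨fun _ => t, fun _ => sobolevExponent (β / n) t, isLogHolder_const ht1,
    isLogHolder_const (ht1.trans_le (le_sobolevExponent (by positivity) ht0 hα)), ?_,
    fun _ => one_div_sobolevExponent _ t⟩
  rwa [essSup_const']

end ConstantExponent

section Equivalence

variable {β : ℝ} {b r q : Qpn p n → ℝ}

lemma AdmissiblePair.memLipschitz_of_oscillation_lt_top (hrq : AdmissiblePair β r q)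
    (hb : LocallyIntegrable b (haar p n)) (h : oscillation β b q < ∞) : MemLipschitz β b := by
  obtain ⟨K, hK⟩ := hrq.exists_setLAverage_sub_average_le (b := b)
  refine memLipschitz_of_setLAverage_sub_average_le hrq.beta_pos hb
    (A := K * (oscillation β b q).toNNReal) fun γ x => ?_
  rw [ENNReal.coe_mul, ENNReal.coe_toNNReal h.ne]
  exact hK γ x

end Equivalence

end PadicVar

theorem corollary4_general (p : ℕ) [Fact p.Prime] (n : ℕ) (β : ℝ) (hβ0 : 0 < β) (hβn : β < n)
    (b : PadicVar.Qpn p n → ℝ) (hb : LocallyIntegrable b (PadicVar.haar p n)) :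
    List.TFAE [
      PadicVar.MemLipschitz β b,
      ∀ r q : PadicVar.Qpn p n → ℝ, PadicVar.AdmissiblePair β r q →
        PadicVar.CommutatorBounded b r q,
      ∃ r q : PadicVar.Qpn p n → ℝ, PadicVar.AdmissiblePair β r q ∧
        PadicVar.CommutatorBounded b r q,
      ∃ r q : PadicVar.Qpn p n → ℝ, PadicVar.AdmissiblePair β r q ∧
        PadicVar.oscillation β b q < ∞,
      ∀ r q : PadicVar.Qpn p n → ℝ, PadicVar.AdmissiblePair β r q →
        PadicVar.oscillation β b q < ∞] := by
  obtain ⟨r₀, q₀, h₀⟩ := PadicVar.exists_admissiblePair (p := p) hβ0 hβn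
  tfae_have 1 → 2 := fun h r q hrq =>
    h.commutatorBounded hb.aestronglyMeasurable.aemeasurable hrq
  tfae_have 2 → 3 := fun h => ⟨r₀, q₀, h₀, h r₀ q₀ h₀⟩
  tfae_have 3 → 4 := fun ⟨r, q, hrq, h⟩ => ⟨r, q, hrq, h.oscillation_lt_top hb hrq⟩
  tfae_have 4 → 1 := fun ⟨r, q, hrq, h⟩ => hrq.memLipschitz_of_oscillation_lt_top hb h
  tfae_have 1 → 5 := fun h r q hrq => h.oscillation_lt_top hrq.dim_ne_zero hβ0.le hb fun y =>
    zero_le_one.trans (hrq.logHolder_q.isExponent.one_lt y).le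
  tfae_have 5 → 4 := fun h => ⟨r₀, q₀, h₀, h r₀ q₀ h₀⟩
  tfae_finish

theorem corollary4 (p : ℕ) [Fact p.Prime] (n : ℕ) (hn : 1 ≤ n) (β : ℝ) (hβ0 : 0 < β) (hβ1 : β < 1)
    (b : PadicVar.Qpn p n → ℝ) (hb : LocallyIntegrable b (PadicVar.haar p n)) :
    List.TFAE [
      PadicVar.MemLipschitz β b,
      ∀ r q : PadicVar.Qpn p n → ℝ, PadicVar.AdmissiblePair β r q →
        PadicVar.CommutatorBounded b r q,
      ∃ r q : PadicVar.Qpn p n → ℝ, PadicVar.AdmissiblePair β r q ∧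
        PadicVar.CommutatorBounded b r q,
      ∃ r q : PadicVar.Qpn p n → ℝ, PadicVar.AdmissiblePair β r q ∧
        PadicVar.oscillation β b q < ∞,
      ∀ r q : PadicVar.Qpn p n → ℝ, PadicVar.AdmissiblePair β r q →
        PadicVar.oscillation β b q < ∞] :=
  corollary4_general p n β hβ0 (hβ1.trans_le (by exact_mod_cast hn)) b hb
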